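/- **Exact soliton-like solutions of the dispersive 4-wave system.** Let $\alpha_1,\alpha_2,\beta_1,\beta_2,\gamma\in\mathbb R$ with $\alpha_1+\beta_1=\alpha_2+\beta_2$, and put $b_k=\frac{\beta_k-\alpha_k}{2}$ $(k=1,2)$, $b=-\frac{\beta_1+\alpha_1}{2}$. Write $\partial_\xi=\partial_y+\partial_x$, $\partial_\eta=\partial_y-\partial_x$. The dispersive 4-wave system for $q_1,\dots,q_4$, functions of $(x,y;t)\in\mathbb R^3$, is, for $k=1,2$, $$\partial_tq_k+\alpha_k\partial_xq_k-\beta_k\partial_yq_k-i\gamma\,\partial^2_{xy}q_k=\sum_{m=1}^2p_{km}q_m-p\,q_k,$$ $$\partial_tq_{2+k}+\alpha_k\partial_xq_{2+k}-\beta_k\partial_yq_{2+k}+i\gamma\,\partial^2_{xy}q_{2+k}=p\,q_{2+k}-\sum_{m=1}^2p_{mk}q_{2+m},\tag{A}$$ where the quasi-potentials satisfy $$\partial_\xi p=i\gamma\,\partial_x(q_1q_3+q_2q_4),\qquad \partial_\eta p_{km}=(\beta_m-\beta_k)\,q_kq_{2+m}-i\gamma\,\partial_x(q_kq_{2+m}),\quad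 k,m=1,2.\tag{B}$$ Let $f_1,\dots,f_4,g_1,\dots,g_4:\mathbb R\times\mathbb R\to\mathbb C$ be functions of one space variable and of $t$. Each of them is jointly $C^1$, is $C^2$ in the space variable with jointly continuous second derivative, and is, together with its first two space derivatives, square integrable over a half-line, with a bound on the $L^2$ norms that is uniform for $t$ in bounded sets; the half-line is $[0,\infty)$ for $f_2,f_4,g_1,g_3$ and $(-\infty,0]$ for $f_1,f_3,g_2,g_4$. Suppose that $$\partial_tf_1-2b_1f_1'-i\gamma f_1''=0,\quad \partial_tf_2+2bf_2'+i\gamma f_2''=0,\quad \partial_tf_3-2b_2f_3'-i\gamma f_3''=0,\quad \partial_tf_4+2bf_4'+i\gamma f_4''=0,$$ $$\partial_tg_1+2bg_1'-i\gamma g_1''=0,\quad \partial_tg_2-2b_1g_2'+i\gamma g_2''=0,\quad \partial_tg_3+2bg_3'-i\gamma g_3''=0,\quad \partial_tg_4-2b_2g_4'+i\gamma g_4''=0.$$ Put $$F_{12}(y,\tau;t)=\begin{pmatrix}f_1(y;t)f_2(\tau;t)\\ f_3(y;t)f_4(\tau;t)\end{pmatrix},\qquad G_{21}(y,\tau;t)=\begin{pmatrix}g_1(y;t)g_2(\tau;t)&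 g_3(y;t)g_4(\tau;t)\end{pmatrix},$$ and, as functions of $(x,y;t)$ (with $t$ suppressed in the integrands), $$\alpha_{12}=\int_{-\infty}^yg_2(s+x)f_1(s+x)\,ds,\qquad \alpha_{34}=\int_{-\infty}^yg_4(s+x)f_3(s+x)\,ds,$$ $$\alpha_{21}=\int_y^\infty f_2(s-x)g_1(s-x)\,ds,\quad \alpha_{41}=\int_y^\infty f_4(s-x)g_1(s-x)\,ds,$$ $$\alpha_{23}=\int_y^\infty f_2(s-x)g_3(s-x)\,ds,\quad \alpha_{43}=\int_y^\infty f_4(s-x)g_3(s-x)\,ds,$$ $$\Delta=1-\alpha_{12}\alpha_{21}-\alpha_{34}\alpha_{43}+\alpha_{12}\alpha_{21}\alpha_{34}\alpha_{43}-\alpha_{34}\alpha_{41}\alpha_{12}\alpha_{23}.$$ (1) *Explicit solution of the Gelfand–Levitan–Marchenko equations.* At every $(x,y,t)$ with $\Delta(x,y;t)\neq0$ the equations $$K^-(x,y,\tau;t)-\int_{-\infty}^y\Big[\int_y^\infty K^-(x,y,z;t)\,G_{21}(z-x,s+x;t)\,dz\Big]F_{12}(s+x,\tau-x;t)\,ds=F_{12}(y+x,\tau-x;t),\quad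 \tau\ge y,$$ $$K^+(x,y,\tau;t)-\int_y^\infty\Big[\int_{-\infty}^yK^+(x,y,z;t)\,F_{12}(z+x,s-x;t)\,dz\Big]G_{21}(s-x,\tau+x;t)\,ds=G_{21}(y-x,\tau+x;t),\quad \tau\le y,$$ for a column $K^-=(K^-_1,K^-_2)^{T}$ and a row $K^+=(K^+_1,K^+_2)$ have unique solutions $K^-(x,y,\cdot\,;t)\in L^2((y,\infty);\mathbb C^2)$ and $K^+(x,y,\cdot\,;t)\in L^2((-\infty,y);\mathbb C^2)$, namely $$K_1^-=a_{11}f_2(\tau-x)f_1(y+x)+a_{12}f_4(\tau-x)f_1(y+x),\qquad K_2^-=a_{21}f_2(\tau-x)f_3(y+x)+a_{22}f_4(\tau-x)f_3(y+x),$$ $$K_1^+=b_{11}g_2(\tau+x)g_1(y-x)+b_{12}g_2(\tau+x)g_3(y-x),\qquad K_2^+=b_{21}g_4(\tau+x)g_1(y-x)+b_{22}g_4(\tau+x)g_3(y-x),$$ with $$a_{11}=b_{11}=\frac{1-\alpha_{34}\alpha_{43}}{\Delta},\quad a_{22}=b_{22}=\frac{1-\alpha_{12}\alpha_{21}}{\Delta},\quad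 a_{12}=\frac{\alpha_{34}\alpha_{23}}{\Delta},\quad a_{21}=\frac{\alpha_{12}\alpha_{41}}{\Delta},\quad b_{12}=\frac{\alpha_{34}\alpha_{41}}{\Delta},\quad b_{21}=\frac{\alpha_{12}\alpha_{23}}{\Delta}.$$ (2) *Explicit solution of the 4-wave system.* The functions $$q_1=-2K_1^-(x,y,y;t),\quad q_2=-2K_2^-(x,y,y;t),\quad q_3=2K_1^+(x,y,y;t),\quad q_4=2K_2^+(x,y,y;t)$$ form a classical solution of the dispersive 4-wave system wherever $\Delta\ne0$: there are functions $p$, $p_{km}$ $(k,m=1,2)$ such that (A) and (B) hold at every $(x,y,t)$ with $\Delta(x,y;t)\neq0$; there the $q_k$ are $C^1$ in $(x,y,t)$ and $C^2$ in $(x,y)$, and $p$, $p_{km}$ are continuous in $(x,y,t)$ and $C^1$ in $(x,y)$. If moreover the $L^2$ bounds on the factors and their first two space derivatives hold over all of $\mathbb R$, then $p$, $p_{km}$ can be chosen so that, for all $x,t$, $p_{km}(x,y;t)\to0$ as $y\to+\infty$ and $p(x,y;t)\to0$ as $y\to-\infty$. -/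

import Mathlib

open MeasureTheory Set Filter Topology
open scoped NNReal

namespace FourWave

noncomputable section

/-! ## Partial derivatives -/

/-- `∂f/∂y` for a function `f (y; t)`. -/
def dSpace (f : ℝ → ℝ → ℂ) (y t : ℝ) : ℂ := deriv (fun z => f z t) y

/-- `∂f/∂t` for a function `f (y; t)`. -/
def dTime (f : ℝ → ℝ → ℂ) (y t : ℝ) : ℂ := deriv (fun s => f y s) t

/-- `∂u/∂x` for a function `u (x, y; t)`. -/
def dx (u : ℝ → ℝ → ℝ → ℂ) (x y t : ℝ) : ℂ := deriv (fun z => u z y t) x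

/-- `∂u/∂y` for a function `u (x, y; t)`. -/
def dy (u : ℝ → ℝ → ℝ → ℂ) (x y t : ℝ) : ℂ := deriv (fun z => u x z t) y

/-- `∂u/∂t` for a function `u (x, y; t)`. -/
def dt (u : ℝ → ℝ → ℝ → ℂ) (x y t : ℝ) : ℂ := deriv (fun s => u x y s) t

/-- `∂/∂ξ = ∂/∂y + ∂/∂x`. -/
def dXi (u : ℝ → ℝ → ℝ → ℂ) (x y t : ℝ) : ℂ := dy u x y t + dx u x y t

/-- `∂/∂η = ∂/∂y - ∂/∂x`. -/
def dEta (u : ℝ → ℝ → ℝ → ℂ) (x y t : ℝ) : ℂ := dy u x y t - dx u x y t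

/-! ## The dispersive 4-wave system -/

/-- `u = (q₁, q₂)` and `v = (q₃, q₄)` form, together with the quasi-potentials `p` and
`P = (p_{km})`, a classical solution of the dispersive 4-wave interaction system at every point
`(x, y, t)` of `Ω`. The case `k = m` of `eqP` is the equation of `p_{kk}`. -/
structure IsSolutionOn (Ω : Set (ℝ × ℝ × ℝ)) (α β : Fin 2 → ℝ) (γ : ℝ)
    (u v : Fin 2 → ℝ → ℝ → ℝ → ℂ) (p : ℝ → ℝ → ℝ → ℂ)
    (P : Fin 2 → Fin 2 → ℝ → ℝ → ℝ → ℂ) : Prop where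
  regU : ∀ k x y t, (x, y, t) ∈ Ω →
    ContDiffAt ℝ 1 (fun z : ℝ × ℝ × ℝ => u k z.1 z.2.1 z.2.2) (x, y, t) ∧
    ContDiffAt ℝ 2 (fun w : ℝ × ℝ => u k w.1 w.2 t) (x, y)
  regV : ∀ k x y t, (x, y, t) ∈ Ω →
    ContDiffAt ℝ 1 (fun z : ℝ × ℝ × ℝ => v k z.1 z.2.1 z.2.2) (x, y, t) ∧
    ContDiffAt ℝ 2 (fun w : ℝ × ℝ => v k w.1 w.2 t) (x, y)
  regp : ∀ x y t, (x, y, t) ∈ Ω →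
    ContinuousAt (fun z : ℝ × ℝ × ℝ => p z.1 z.2.1 z.2.2) (x, y, t) ∧
    ContDiffAt ℝ 1 (fun w : ℝ × ℝ => p w.1 w.2 t) (x, y)
  regP : ∀ k m x y t, (x, y, t) ∈ Ω →
    ContinuousAt (fun z : ℝ × ℝ × ℝ => P k m z.1 z.2.1 z.2.2) (x, y, t) ∧
    ContDiffAt ℝ 1 (fun w : ℝ × ℝ => P k m w.1 w.2 t) (x, y)
  eqU : ∀ k x y t, (x, y, t) ∈ Ω →
    dt (u k) x y t + α k * dx (u k) x y t - β k * dy (u k) x y t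
        - Complex.I * γ * dx (dy (u k)) x y t
      = ∑ m, P k m x y t * u m x y t - p x y t * u k x y t
  eqV : ∀ k x y t, (x, y, t) ∈ Ω →
    dt (v k) x y t + α k * dx (v k) x y t - β k * dy (v k) x y t
        + Complex.I * γ * dx (dy (v k)) x y t
      = p x y t * v k x y t - ∑ m, P m k x y t * v m x y t
  eqp : ∀ x y t, (x, y, t) ∈ Ω →
    dXi p x y t
      = Complex.I * γ * dx (fun x' y' t' => ∑ m, u m x' y' t' * v m x' y' t') x y t
  eqP : ∀ k m x y t, (x, y, t) ∈ Ω →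
    dEta (P k m) x y t
      = (β m - β k) * (u k x y t * v m x y t)
        - Complex.I * γ * dx (fun x' y' t' => u k x' y' t' * v m x' y' t') x y t

/-! ## Degenerate scattering data -/

/-- The factors of degenerate scattering data; each is a function of one space variable and `t`. -/
structure DegenerateData where
  f₁ : ℝ → ℝ → ℂ
  f₂ : ℝ → ℝ → ℂ
  f₃ : ℝ → ℝ → ℂ
  f₄ : ℝ → ℝ → ℂ
  g₁ : ℝ → ℝ → ℂ
  g₂ : ℝ → ℝ → ℂ
  g₃ : ℝ → ℝ → ℂ
  g₄ : ℝ → ℝ → ℂ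

/-- Regularity of a factor `f (y; t)`: it is jointly `C¹`, it is `C²` in `y` with jointly
continuous second derivative, and `f`, `∂f/∂y`, `∂²f/∂y²` are square integrable over `S`,
with a bound that is uniform for `t` in bounded sets. -/
structure IsFactor (S : Set ℝ) (f : ℝ → ℝ → ℂ) : Prop where
  contDiff : ContDiff ℝ 1 (fun z : ℝ × ℝ => f z.1 z.2)
  contDiff_space : ∀ t, ContDiff ℝ 2 (fun y => f y t)
  continuous_second : Continuous (fun z : ℝ × ℝ => dSpace (dSpace f) z.1 z.2)
  l2_bound : ∀ T : ℝ, ∃ C : ℝ≥0, ∀ t : ℝ, |t| ≤ T →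
    eLpNorm (fun y => f y t) 2 (volume.restrict S) ≤ C ∧
    eLpNorm (fun y => dSpace f y t) 2 (volume.restrict S) ≤ C ∧
    eLpNorm (fun y => dSpace (dSpace f) y t) 2 (volume.restrict S) ≤ C

namespace DegenerateData

variable (d : DegenerateData)

/-- The factors are regular, and square integrable near the end of the line towards which
they are integrated in the Gelfand-Levitan-Marchenko equations. -/
structure HalfLineRegular : Prop where
  f₁ : IsFactor (Iic 0) d.f₁
  f₂ : IsFactor (Ici 0) d.f₂
  f₃ : IsFactor (Iic 0) d.f₃
  f₄ : IsFactor (Ici 0) d.f₄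
  g₁ : IsFactor (Ici 0) d.g₁
  g₂ : IsFactor (Iic 0) d.g₂
  g₃ : IsFactor (Ici 0) d.g₃
  g₄ : IsFactor (Iic 0) d.g₄

/-- The factors are regular and square integrable over the whole line. -/
structure LineRegular : Prop where
  f₁ : IsFactor univ d.f₁
  f₂ : IsFactor univ d.f₂
  f₃ : IsFactor univ d.f₃
  f₄ : IsFactor univ d.f₄
  g₁ : IsFactor univ d.g₁
  g₂ : IsFactor univ d.g₂
  g₃ : IsFactor univ d.g₃
  g₄ : IsFactor univ d.g₄

/-- The linear evolution equations of the factors, in which `b₁`, `b₂`, `b` are the entries of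
the diagonal matrix `diag (2 b₁, 2 b₂, 2 b)` of the Lax pair. -/
structure Evolves (b₁ b₂ b γ : ℝ) : Prop where
  f₁ : ∀ y t, dTime d.f₁ y t - 2 * b₁ * dSpace d.f₁ y t
    - Complex.I * γ * dSpace (dSpace d.f₁) y t = 0
  f₂ : ∀ y t, dTime d.f₂ y t + 2 * b * dSpace d.f₂ y t
    + Complex.I * γ * dSpace (dSpace d.f₂) y t = 0
  f₃ : ∀ y t, dTime d.f₃ y t - 2 * b₂ * dSpace d.f₃ y t
    - Complex.I * γ * dSpace (dSpace d.f₃) y t = 0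
  f₄ : ∀ y t, dTime d.f₄ y t + 2 * b * dSpace d.f₄ y t
    + Complex.I * γ * dSpace (dSpace d.f₄) y t = 0
  g₁ : ∀ y t, dTime d.g₁ y t + 2 * b * dSpace d.g₁ y t
    - Complex.I * γ * dSpace (dSpace d.g₁) y t = 0
  g₂ : ∀ y t, dTime d.g₂ y t - 2 * b₁ * dSpace d.g₂ y t
    + Complex.I * γ * dSpace (dSpace d.g₂) y t = 0
  g₃ : ∀ y t, dTime d.g₃ y t + 2 * b * dSpace d.g₃ y t
    - Complex.I * γ * dSpace (dSpace d.g₃) y t = 0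
  g₄ : ∀ y t, dTime d.g₄ y t - 2 * b₂ * dSpace d.g₄ y t
    + Complex.I * γ * dSpace (dSpace d.g₄) y t = 0

/-- The column `F₁₂ (y, τ; t)`. -/
def F (y τ t : ℝ) : Fin 2 → ℂ := ![d.f₁ y t * d.f₂ τ t, d.f₃ y t * d.f₄ τ t]

/-- The row `G₂₁ (y, τ; t)`. -/
def G (y τ t : ℝ) : Fin 2 → ℂ := ![d.g₁ y t * d.g₂ τ t, d.g₃ y t * d.g₄ τ t]

/-! ### The Gelfand-Levitan-Marchenko equations -/

/-- The equation for the column `K⁻ (x, y, ·; t)`, at the point `τ ≥ y`: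
`K⁻(τ) - ∫_{-∞}^y [∫_y^∞ K⁻(z) G₂₁(z - x, s + x) dz] F₁₂(s + x, τ - x) ds = F₁₂(y + x, τ - x)`,
where `K⁻ G₂₁` is a product of a column and a row. -/
def GLMMinus (x y t : ℝ) (K : ℝ → Fin 2 → ℂ) (τ : ℝ) : Prop :=
  ∀ i, K τ i - ∫ s in Iic y, ∑ j,
      (∫ z in Ici y, K z i * d.G (z - x) (s + x) t j) * d.F (s + x) (τ - x) t j
    = d.F (y + x) (τ - x) t i

/-- The equation for the row `K⁺ (x, y, ·; t)`, at the point `τ ≤ y`: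
`K⁺(τ) - ∫_y^∞ [∫_{-∞}^y K⁺(z) F₁₂(z + x, s - x) dz] G₂₁(s - x, τ + x) ds = G₂₁(y - x, τ + x)`,
where `K⁺ F₁₂` is a product of a row and a column. -/
def GLMPlus (x y t : ℝ) (K : ℝ → Fin 2 → ℂ) (τ : ℝ) : Prop :=
  ∀ j, K τ j - ∫ s in Ici y,
      (∫ z in Iic y, ∑ i, K z i * d.F (z + x) (s - x) t i) * d.G (s - x) (τ + x) t j
    = d.G (y - x) (τ + x) t j

/-! ### The explicit kernels -/

/-- The integral `α₁₂ = β₁₂`. -/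
def α₁₂ (x y t : ℝ) : ℂ := ∫ s in Iic y, d.g₂ (s + x) t * d.f₁ (s + x) t

/-- The integral `α₃₄ = β₃₄`. -/
def α₃₄ (x y t : ℝ) : ℂ := ∫ s in Iic y, d.g₄ (s + x) t * d.f₃ (s + x) t

/-- The integral `α₂₁ = β₂₁`. -/
def α₂₁ (x y t : ℝ) : ℂ := ∫ s in Ici y, d.f₂ (s - x) t * d.g₁ (s - x) t

/-- The integral `α₄₁ = β₄₁`. -/
def α₄₁ (x y t : ℝ) : ℂ := ∫ s in Ici y, d.f₄ (s - x) t * d.g₁ (s - x) t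

/-- The integral `α₂₃ = β₂₃`. -/
def α₂₃ (x y t : ℝ) : ℂ := ∫ s in Ici y, d.f₂ (s - x) t * d.g₃ (s - x) t

/-- The integral `α₄₃ = β₄₃`. -/
def α₄₃ (x y t : ℝ) : ℂ := ∫ s in Ici y, d.f₄ (s - x) t * d.g₃ (s - x) t

/-- The common denominator of the coefficients. -/
def Δ (x y t : ℝ) : ℂ :=
  1 - d.α₁₂ x y t * d.α₂₁ x y t - d.α₃₄ x y t * d.α₄₃ x y t
    + d.α₁₂ x y t * d.α₂₁ x y t * d.α₃₄ x y t * d.α₄₃ x y t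
    - d.α₃₄ x y t * d.α₄₁ x y t * d.α₁₂ x y t * d.α₂₃ x y t

def a₁₁ (x y t : ℝ) : ℂ := (1 - d.α₃₄ x y t * d.α₄₃ x y t) / d.Δ x y t

def a₁₂ (x y t : ℝ) : ℂ := (d.α₃₄ x y t * d.α₂₃ x y t) / d.Δ x y t

def a₂₁ (x y t : ℝ) : ℂ := (d.α₁₂ x y t * d.α₄₁ x y t) / d.Δ x y t

def a₂₂ (x y t : ℝ) : ℂ := (1 - d.α₁₂ x y t * d.α₂₁ x y t) / d.Δ x y t

def b₁₁ (x y t : ℝ) : ℂ := (1 - d.α₃₄ x y t * d.α₄₃ x y t) / d.Δ x y t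

def b₁₂ (x y t : ℝ) : ℂ := (d.α₃₄ x y t * d.α₄₁ x y t) / d.Δ x y t

def b₂₁ (x y t : ℝ) : ℂ := (d.α₁₂ x y t * d.α₂₃ x y t) / d.Δ x y t

def b₂₂ (x y t : ℝ) : ℂ := (1 - d.α₁₂ x y t * d.α₂₁ x y t) / d.Δ x y t

/-- The explicit column `K⁻ (x, y, τ; t)`. -/
def Kminus (x y τ t : ℝ) : Fin 2 → ℂ :=
  ![d.a₁₁ x y t * d.f₂ (τ - x) t * d.f₁ (y + x) t
      + d.a₁₂ x y t * d.f₄ (τ - x) t * d.f₁ (y + x) t,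
    d.a₂₁ x y t * d.f₃ (y + x) t * d.f₂ (τ - x) t
      + d.a₂₂ x y t * d.f₃ (y + x) t * d.f₄ (τ - x) t]

/-- The explicit row `K⁺ (x, y, τ; t)`. -/
def Kplus (x y τ t : ℝ) : Fin 2 → ℂ :=
  ![d.b₁₁ x y t * d.g₂ (τ + x) t * d.g₁ (y - x) t
      + d.b₁₂ x y t * d.g₂ (τ + x) t * d.g₃ (y - x) t,
    d.b₂₁ x y t * d.g₄ (τ + x) t * d.g₁ (y - x) t
      + d.b₂₂ x y t * d.g₄ (τ + x) t * d.g₃ (y - x) t]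

/-- `(q₁, q₂)`. -/
def q₁₂ (k : Fin 2) (x y t : ℝ) : ℂ := -2 * d.Kminus x y y t k

/-- `(q₃, q₄)`. -/
def q₂₁ (k : Fin 2) (x y t : ℝ) : ℂ := 2 * d.Kplus x y y t k

end DegenerateData

end

end FourWave

/-!
Each entry of `F₁₂` and `G₂₁` is a product, so everything reduces to two-by-two matrices.
Write `r = y + x`, `s = y - x`, let `A (r; t)` be the diagonal matrix of the integrals
`∫_{-∞}^r g_2 f_1`, `∫_{-∞}^r g_4 f_3`, and let `M (s; t)` be the matrix of the integrals over
`[s, ∞)` of the products of `f_2, f_4` with `g_1, g_3`. Then `Δ = det (1 - M A)`.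

*The Gelfand-Levitan-Marchenko equations.* A solution is a combination of the factors whose
coefficients are moments of the solution itself (`glmMinus_iff`, `glmPlus_iff`). Taking moments
turns the equation into a linear system with matrix `1 - M A` or `1 - A M`, which is uniquely
solvable precisely because `Δ ≠ 0` (`eq_add_iff_resR`, `eq_add_iff_resRow`).

*The four-wave system.* The four matrices `R = (1 - M A)⁻¹`, `N = (1 - A M)⁻¹`, `X = A R = N A` and
`Y = R M = M N` are closed under differentiation:
`dR = R dM X + Y dA R`, `dN = X dM N + N dA Y`, `dX = X dM X + N dA R`, `dY = R dM N + Y dA Y`.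
Here `∂A/∂r` is diagonal and `∂M/∂s` has rank one, so the potential `q` and all its derivatives are
polynomials in `Y`, in the columns `R u`, the rows `v N` and the scalars `v X u`, where `u`, `v` are
`(f_2, f_4)`, `(g_1, g_3)` and their derivatives, and in the factors `φ = (f_1, f_3)`,
`ψ = (g_2, g_4)` and their derivatives. With `Z = (g_1, g_3) X (f_2, f_4)ᵀ` and
`W_{km} = φ_k Y_{km} ψ_m` one has `q_1 q_3 + q_2 q_4 = -4 ∂Z/∂r` and `q_k q_{2+m} = 4 ∂W_{km}/∂s`.
Since `∂_ξ = 2 ∂_r` and `∂_η = 2 ∂_s`, the equations for the quasi-potentials are integrated by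
`p = -2iγ (∂_r - ∂_s) Z` and `p_{km} = 2 (b_m - b_k) W_{km} - 2iγ (∂_r - ∂_s) W_{km}`, and the
evolution equations become polynomial identities (`eq_q₁₂`, `eq_q₂₁`).

*Time dependence.* The density `f g` of a solution `f` of one of the linear evolution equations and
a solution `g` of the adjoint equation is conserved, so the time derivatives of `A` and `M` are
values of a flux (`hasDerivAt_time_integral_Iic`, `hasDerivAt_time_integral_Ici`). The `L²` bounds make
the factors and their first derivatives vanish at the relevant end of the line, boundedly for bounded
times (`decay_Iic`), which removes the contribution of infinity.
-/

namespace FourWave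

/-! ### One-dimensional analysis -/

/-- A function of two real variables with jointly continuous partial derivatives is `C¹`. -/
lemma contDiff_one_of_hasDerivAt_partial {u u₁ u₂ : ℝ → ℝ → ℂ}
    (h₁ : ∀ y t, HasDerivAt (fun z => u z t) (u₁ y t) y)
    (h₂ : ∀ y t, HasDerivAt (fun s => u y s) (u₂ y t) t)
    (c₁ : Continuous fun z : ℝ × ℝ => u₁ z.1 z.2) (c₂ : Continuous fun z : ℝ × ℝ => u₂ z.1 z.2) :
    ContDiff ℝ 1 fun z : ℝ × ℝ => u z.1 z.2 := by
  let S : ℂ →L[ℝ] (ℝ →L[ℝ] ℂ) := ContinuousLinearMap.smulRightL ℝ ℝ ℂ (1 : ℝ →L[ℝ] ℝ)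
  have hS : ∀ c : ℂ, S c = ContinuousLinearMap.toSpanSingleton ℝ c := by
    intro c; ext; simp [S]
  have e₁ : Continuous fun z : ℝ × ℝ => S (u₁ z.1 z.2) := S.continuous.comp c₁
  have e₂ : Continuous fun z : ℝ × ℝ => S (u₂ z.1 z.2) := S.continuous.comp c₂
  have key : ∀ z : ℝ × ℝ, HasStrictFDerivAt (fun z : ℝ × ℝ => u z.1 z.2)
      ((S (u₁ z.1 z.2)).coprod (S (u₂ z.1 z.2))) z := by
    intro z
    refine hasStrictFDerivAt_uncurry_coprod (f := u) (f₁ := fun y t => S (u₁ y t))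
      (f₂ := fun y t => S (u₂ y t)) ?_ ?_ e₁.continuousAt e₂.continuousAt
    · refine Eventually.of_forall fun v => ?_
      have := (h₁ v.1 v.2).hasFDerivAt
      simpa only [Function.HasUncurry.uncurry, id, hS] using this
    · refine Eventually.of_forall fun v => ?_
      have := (h₂ v.1 v.2).hasFDerivAt
      simpa only [Function.HasUncurry.uncurry, id, hS] using this
  rw [contDiff_one_iff_hasFDerivAt]
  refine ⟨_, ?_, fun z => (key z).hasFDerivAt⟩
  have e : (fun z : ℝ × ℝ => (S (u₁ z.1 z.2)).coprod (S (u₂ z.1 z.2))) = fun z : ℝ × ℝ =>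
      (S (u₁ z.1 z.2)).comp (ContinuousLinearMap.fst ℝ ℝ ℝ)
        + (S (u₂ z.1 z.2)).comp (ContinuousLinearMap.snd ℝ ℝ ℝ) := by
    funext z; ext <;> simp
  rw [e]
  exact (e₁.clm_comp continuous_const).add (e₂.clm_comp continuous_const)

lemma integrableOn_Iic_of_continuous {E : Type*} [NormedAddCommGroup E] {h : ℝ → E}
    (hc : Continuous h) {a : ℝ}
    (hi : IntegrableOn h (Iic a)) (r : ℝ) : IntegrableOn h (Iic r) := by
  refine (hi.union (hc.integrableOn_Icc (a := a) (b := r))).mono_set fun x hx => ?_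
  rcases le_total x a with h | h
  · exact Or.inl h
  · exact Or.inr ⟨h, hx⟩

lemma integrableOn_Ici_of_continuous {E : Type*} [NormedAddCommGroup E] {h : ℝ → E}
    (hc : Continuous h) {a : ℝ}
    (hi : IntegrableOn h (Ici a)) (r : ℝ) : IntegrableOn h (Ici r) := by
  refine (hi.union (hc.integrableOn_Icc (a := r) (b := a))).mono_set fun x hx => ?_
  rcases le_total a x with h | h
  · exact Or.inl h
  · exact Or.inr ⟨hx, h⟩

lemma setIntegral_Ici_eq_comp_neg (h : ℝ → ℂ) (s : ℝ) :
    ∫ z in Ici s, h z = ∫ z in Iic (-s), h (-z) := by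
  rw [integral_comp_neg_Iic, neg_neg, integral_Ici_eq_integral_Ioi]

lemma hasDerivAt_integral_Iic {h : ℝ → ℂ} (hc : Continuous h) {a : ℝ}
    (hi : IntegrableOn h (Iic a)) (r : ℝ) : HasDerivAt (fun r => ∫ s in Iic r, h s) (h r) r := by
  have e : (fun r => ∫ s in Iic r, h s) = fun r => (∫ s in Iic a, h s) + ∫ s in a..r, h s := by
    funext r
    rw [← intervalIntegral.integral_Iic_sub_Iic hi (integrableOn_Iic_of_continuous hc hi r)]
    ring
  rw [e]
  exact (intervalIntegral.integral_hasDerivAt_right (hc.intervalIntegrable _ _)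
    hc.stronglyMeasurable.stronglyMeasurableAtFilter hc.continuousAt).const_add _

lemma hasDerivAt_integral_Ici {h : ℝ → ℂ} (hc : Continuous h) {a : ℝ}
    (hi : IntegrableOn h (Ici a)) (r : ℝ) :
    HasDerivAt (fun r => ∫ s in Ici r, h s) (-h r) r := by
  have hi' : IntegrableOn (fun z => h (-z)) (Iic (-a)) := by
    have := (Measure.measurePreserving_neg (volume : Measure ℝ)).integrableOn_comp_preimage
      (Homeomorph.neg ℝ).measurableEmbedding (f := h) (s := Ici a)
    rw [← this] at hi
    simpa [Function.comp_def] using hi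
  have := (hasDerivAt_integral_Iic (hc.comp continuous_neg) hi' (-r)).scomp r (hasDerivAt_neg r)
  simp only [setIntegral_Ici_eq_comp_neg h]
  simpa [Function.comp_def] using this

/-- The time derivative of the integral of a conserved density: if `∂h/∂t = ∂W/∂s` and the flux `W`
vanishes at `-∞`, boundedly for bounded times, then `∫_{-∞}^r h` has time derivative `W (r; t)`.
No domination of `∂h/∂t` in `s` is needed, since the balance law on `[l, r]`, integrated in time,
survives the limit `l → -∞` by dominated convergence in time. -/
lemma hasDerivAt_integral_Iic_of_conservation {h W w : ℝ → ℝ → ℂ}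
    (hh : Continuous fun z : ℝ × ℝ => h z.1 z.2) (hw : Continuous fun z : ℝ × ℝ => w z.1 z.2)
    (hW : Continuous fun z : ℝ × ℝ => W z.1 z.2)
    (ht : ∀ s t, HasDerivAt (fun t => h s t) (w s t) t)
    (hs : ∀ s t, HasDerivAt (fun s => W s t) (w s t) s)
    (hint : ∀ t, IntegrableOn (fun s => h s t) (Iic 0))
    (hlim : ∀ t, Tendsto (fun s => W s t) atBot (𝓝 0))
    (hbd : ∀ T : ℝ, ∃ C : ℝ, ∀ s t, s ≤ 0 → |t| ≤ T → ‖W s t‖ ≤ C) (r t : ℝ) :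
    HasDerivAt (fun t => ∫ s in Iic r, h s t) (W r t) t := by
  have hcs : ∀ t, Continuous fun s => h s t := fun t => by fun_prop
  have hws : ∀ t, Continuous fun s => w s t := fun t => by fun_prop
  have hwt : ∀ s, Continuous fun t => w s t := fun t => by fun_prop
  have hWt : ∀ s, Continuous fun t => W s t := fun t => by fun_prop
  have hintr : ∀ t, IntegrableOn (fun s => h s t) (Iic r) := fun t =>
    integrableOn_Iic_of_continuous (hcs t) (hint t) r
  -- the balance law on `[l, r]`, integrated from time `0` to `t`
  have bal : ∀ l t, (∫ s in l..r, h s t) - (∫ s in l..r, h s 0)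
      = (∫ τ in (0:ℝ)..t, W r τ) - ∫ τ in (0:ℝ)..t, W l τ := by
    intro l t
    rw [← intervalIntegral.integral_sub ((hcs t).intervalIntegrable _ _)
      ((hcs 0).intervalIntegrable _ _), ← intervalIntegral.integral_sub
      ((hWt r).intervalIntegrable _ _) ((hWt l).intervalIntegrable _ _)]
    have e₁ : ∀ s, h s t - h s 0 = ∫ τ in (0:ℝ)..t, w s τ := fun s =>
      (intervalIntegral.integral_eq_sub_of_hasDerivAt (fun τ _ => ht s τ)
        ((hwt s).intervalIntegrable _ _)).symm
    have e₂ : ∀ τ, W r τ - W l τ = ∫ s in l..r, w s τ := fun τ =>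
      (intervalIntegral.integral_eq_sub_of_hasDerivAt (fun s _ => hs s τ)
        ((hws τ).intervalIntegrable _ _)).symm
    simp only [e₁, e₂]
    refine intervalIntegral_intervalIntegral_swap ?_
    have : IntegrableOn (fun z : ℝ × ℝ => w z.1 z.2) (uIcc l r ×ˢ uIcc 0 t) :=
      hw.continuousOn.integrableOn_compact (isCompact_uIcc.prod isCompact_uIcc)
    exact this.mono_set (prod_mono uIoc_subset_uIcc uIoc_subset_uIcc)
  -- in the limit `l → -∞` the boundary term disappears
  have key : ∀ t, (∫ s in Iic r, h s t) = (∫ s in Iic r, h s 0) + ∫ τ in (0:ℝ)..t, W r τ := by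
    intro t
    obtain ⟨C, hC⟩ := hbd |t|
    have l₁ := (intervalIntegral_tendsto_integral_Iic r (hintr t) tendsto_id).sub
      (intervalIntegral_tendsto_integral_Iic r (hintr 0) tendsto_id)
    have l₂ : Tendsto (fun l => ∫ τ in (0:ℝ)..t, W l τ) atBot (𝓝 (∫ τ in (0:ℝ)..t, (0:ℂ))) := by
      refine intervalIntegral.tendsto_integral_filter_of_dominated_convergence (fun _ => C)
        (Eventually.of_forall fun l => (hWt l).aestronglyMeasurable) ?_
        intervalIntegrable_const (Eventually.of_forall fun τ _ => hlim τ)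
      filter_upwards [eventually_le_atBot (0:ℝ)] with l hl
      refine Eventually.of_forall fun τ hτ => hC l τ hl ?_
      rcases le_total 0 t with h | h
      · rw [uIoc_of_le h] at hτ
        rw [abs_of_pos hτ.1, abs_of_nonneg h]; exact hτ.2
      · rw [uIoc_of_ge h] at hτ
        rw [abs_of_nonpos hτ.2, abs_of_nonpos h]; linarith [hτ.1]
    have l₃ := (tendsto_const_nhds (x := ∫ τ in (0:ℝ)..t, W r τ)).sub l₂
    have := tendsto_nhds_unique (l₁.congr fun l => bal l t) l₃
    rw [intervalIntegral.integral_zero, sub_zero, sub_eq_iff_eq_add'] at this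
    exact this
  rw [funext key]
  exact (intervalIntegral.integral_hasDerivAt_right ((hWt r).intervalIntegrable _ _)
    (hWt r).stronglyMeasurable.stronglyMeasurableAtFilter (hWt r).continuousAt).const_add _

/-- The mirror image of `hasDerivAt_integral_Iic_of_conservation`. -/
lemma hasDerivAt_integral_Ici_of_conservation {h W w : ℝ → ℝ → ℂ}
    (hh : Continuous fun z : ℝ × ℝ => h z.1 z.2) (hw : Continuous fun z : ℝ × ℝ => w z.1 z.2)
    (hW : Continuous fun z : ℝ × ℝ => W z.1 z.2)
    (ht : ∀ s t, HasDerivAt (fun t => h s t) (w s t) t)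
    (hs : ∀ s t, HasDerivAt (fun s => W s t) (w s t) s)
    (hint : ∀ t, IntegrableOn (fun s => h s t) (Ici 0))
    (hlim : ∀ t, Tendsto (fun s => W s t) atTop (𝓝 0))
    (hbd : ∀ T : ℝ, ∃ C : ℝ, ∀ s t, 0 ≤ s → |t| ≤ T → ‖W s t‖ ≤ C) (r t : ℝ) :
    HasDerivAt (fun t => ∫ s in Ici r, h s t) (-W r t) t := by
  have key := hasDerivAt_integral_Iic_of_conservation (h := fun s t => h (-s) t)
    (W := fun s t => -W (-s) t) (w := fun s t => w (-s) t)
    (hh.comp (by fun_prop : Continuous fun z : ℝ × ℝ => (-z.1, z.2)))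
    (hw.comp (by fun_prop : Continuous fun z : ℝ × ℝ => (-z.1, z.2)))
    (hW.comp (by fun_prop : Continuous fun z : ℝ × ℝ => (-z.1, z.2))).neg
    (fun s t => ht (-s) t)
    (fun s t => by
      simpa [Function.comp_def] using ((hs (-s) t).scomp s (hasDerivAt_neg s)).fun_neg)
    (fun t => by
      have := (Measure.measurePreserving_neg (volume : Measure ℝ)).integrableOn_comp_preimage
        (Homeomorph.neg ℝ).measurableEmbedding (f := fun s => h s t) (s := Ici 0)
      have h0 := hint t
      rw [← this] at h0
      simpa [Function.comp_def] using h0)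
    (fun t => by simpa using ((hlim t).comp tendsto_neg_atBot_atTop).neg)
    (fun T => by
      obtain ⟨C, hC⟩ := hbd T
      exact ⟨C, fun s t hs ht => by simpa using hC (-s) t (by linarith) ht⟩) (-r) t
  simp only [setIntegral_Ici_eq_comp_neg]
  simpa using key

/-- A function that is, with its derivative, square integrable near `-∞` is bounded there by the
`L²` norms, because `f² = ∫ 2 f f'`; it also tends to zero. -/
lemma decay_Iic {f f' : ℝ → ℂ} (hf : ∀ y, HasDerivAt f (f' y) y) (hc : Continuous f') {C : ℝ≥0}
    (h₀ : eLpNorm f 2 (volume.restrict (Iic 0)) ≤ C)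
    (h₁ : eLpNorm f' 2 (volume.restrict (Iic 0)) ≤ C) :
    Tendsto f atBot (𝓝 0) ∧ ∀ y ≤ 0, ‖f y‖ ≤ 2 * C := by
  have hcf : Continuous f := continuous_iff_continuousAt.2 fun y => (hf y).continuousAt
  have m₀ : MemLp f 2 (volume.restrict (Iic 0)) :=
    ⟨hcf.aestronglyMeasurable, h₀.trans_lt ENNReal.coe_lt_top⟩
  have m₁ : MemLp f' 2 (volume.restrict (Iic 0)) :=
    ⟨hc.aestronglyMeasurable, h₁.trans_lt ENNReal.coe_lt_top⟩
  have hd : ∀ y, HasDerivAt (fun y => f y * f y) (2 * (f y * f' y)) y := fun y =>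
    ((hf y).mul (hf y)).congr_deriv (by ring)
  have i₁ : IntegrableOn (fun y => f y * f' y) (Iic 0) := m₀.integrable_mul m₁
  have i₀ : IntegrableOn (fun y => f y * f y) (Iic 0) := m₀.integrable_mul m₀
  have i₂ : IntegrableOn (fun y => 2 * (f y * f' y)) (Iic 0) := i₁.const_mul 2
  have l : Tendsto (fun y => f y * f y) atBot (𝓝 0) :=
    tendsto_zero_of_hasDerivAt_of_integrableOn_Iic (fun y _ => hd y) i₂ i₀
  refine ⟨?_, fun y hy => ?_⟩
  · rw [tendsto_zero_iff_norm_tendsto_zero] at l ⊢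
    have := (Real.continuous_sqrt.tendsto _).comp l
    simpa [Function.comp_def] using this
  · have e := integral_Iic_of_hasDerivAt_of_tendsto' (a := y) (fun y _ => hd y)
      (i₂.mono_set (Iic_subset_Iic.2 hy)) l
    have b : ‖f y * f y‖ₑ ≤ 2 * (C * C) := by
      rw [← sub_zero (f y * f y), ← e]
      calc _ = ‖2 * ∫ y in Iic y, f y * f' y‖ₑ := by rw [integral_const_mul]
        _ = 2 * ‖∫ y in Iic y, f y * f' y‖ₑ := by
            rw [enorm_mul]; congr 1
            rw [← ofReal_norm]; norm_num
        _ ≤ 2 * ∫⁻ y in Iic y, ‖f y * f' y‖ₑ := by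
            gcongr; exact enorm_integral_le_lintegral_enorm _
        _ ≤ 2 * ∫⁻ y in Iic 0, ‖f y * f' y‖ₑ := by
            gcongr
        _ = 2 * eLpNorm (f • f') 1 (volume.restrict (Iic 0)) := by
            rw [eLpNorm_one_eq_lintegral_enorm]; rfl
        _ ≤ 2 * (eLpNorm f 2 (volume.restrict (Iic 0))
            * eLpNorm f' 2 (volume.restrict (Iic 0))) := by
            gcongr
            exact eLpNorm_smul_le_mul_eLpNorm m₁.1 m₀.1
        _ ≤ _ := by gcongr
    have b' : ‖f y‖ * ‖f y‖ ≤ 2 * (C * C) := by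
      have : (‖f y * f y‖₊ : ENNReal) ≤ ((2 * (C * C) : ℝ≥0) : ENNReal) := by
        simpa [enorm_eq_nnnorm] using b
      have := ENNReal.coe_le_coe.1 this
      have : ((‖f y * f y‖₊ : ℝ≥0) : ℝ) ≤ ((2 * (C * C) : ℝ≥0) : ℝ) := by exact_mod_cast this
      simpa [norm_mul] using this
    by_contra! hlt
    have hC : (0 : ℝ) ≤ C := C.2
    nlinarith [norm_nonneg (f y)]

/-- The mirror image of `decay_Iic`. -/
lemma decay_Ici {f f' : ℝ → ℂ} (hf : ∀ y, HasDerivAt f (f' y) y) (hc : Continuous f') {C : ℝ≥0}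
    (h₀ : eLpNorm f 2 (volume.restrict (Ici 0)) ≤ C)
    (h₁ : eLpNorm f' 2 (volume.restrict (Ici 0)) ≤ C) :
    Tendsto f atTop (𝓝 0) ∧ ∀ y, 0 ≤ y → ‖f y‖ ≤ 2 * C := by
  have hcf : Continuous f := continuous_iff_continuousAt.2 fun y => (hf y).continuousAt
  have mp := (Measure.measurePreserving_neg (volume : Measure ℝ)).restrict_preimage
    (measurableSet_Ici (a := (0:ℝ)))
  have hp : Neg.neg ⁻¹' Ici (0:ℝ) = Iic 0 := by ext; simp
  rw [hp] at mp
  obtain ⟨l, bd⟩ := decay_Iic (f := fun y => f (-y)) (f' := fun y => -f' (-y)) (C := C)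
    (fun y => by simpa [Function.comp_def] using (hf (-y)).scomp y (hasDerivAt_neg y))
    (by fun_prop)
    (by rw [← eLpNorm_comp_measurePreserving hcf.aestronglyMeasurable mp] at h₀; exact h₀)
    (by
      rw [← eLpNorm_comp_measurePreserving hc.aestronglyMeasurable mp] at h₁
      rw [← eLpNorm_neg] at h₁; exact h₁)
  refine ⟨?_, fun y hy => by simpa using bd (-y) (by linarith)⟩
  simpa [Function.comp_def] using l.comp tendsto_neg_atTop_atBot

/-! ### Factors -/

namespace IsFactor

variable {S : Set ℝ} {f g : ℝ → ℝ → ℂ}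

lemma mono {S' : Set ℝ} (h : IsFactor S f) (hS : S' ⊆ S) : IsFactor S' f where
  contDiff := h.contDiff
  contDiff_space := h.contDiff_space
  continuous_second := h.continuous_second
  l2_bound T := by
    obtain ⟨C, hC⟩ := h.l2_bound T
    have hm := Measure.restrict_mono hS (le_refl (volume : Measure ℝ))
    refine ⟨C, fun t ht => ⟨?_, ?_, ?_⟩⟩
    · exact (eLpNorm_mono_measure _ hm).trans (hC t ht).1
    · exact (eLpNorm_mono_measure _ hm).trans (hC t ht).2.1
    · exact (eLpNorm_mono_measure _ hm).trans (hC t ht).2.2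

lemma continuous (h : IsFactor S f) : Continuous fun z : ℝ × ℝ => f z.1 z.2 := h.contDiff.continuous

lemma hasDerivAt_space (h : IsFactor S f) (y t : ℝ) :
    HasDerivAt (fun y => f y t) (dSpace f y t) y :=
  ((h.contDiff_space t).differentiable (by norm_num) y).hasDerivAt

lemma contDiff_dSpace (h : IsFactor S f) (t : ℝ) : ContDiff ℝ 1 fun y => dSpace f y t :=
  ((contDiff_succ_iff_deriv (n := 1)).1 (h.contDiff_space t)).2.2

lemma hasDerivAt_dSpace (h : IsFactor S f) (y t : ℝ) :
    HasDerivAt (fun y => dSpace f y t) (dSpace (dSpace f) y t) y :=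
  ((h.contDiff_dSpace t).differentiable (by norm_num) y).hasDerivAt

lemma hasDerivAt_time (h : IsFactor S f) (y t : ℝ) :
    HasDerivAt (fun t => f y t) (dTime f y t) t := by
  have : ContDiff ℝ 1 (fun s => f y s) := h.contDiff.comp (contDiff_prodMk_right y)
  exact (this.differentiable (by norm_num) t).hasDerivAt

lemma continuous_dSpace (h : IsFactor S f) : Continuous fun z : ℝ × ℝ => dSpace f z.1 z.2 := by
  have e : (fun z : ℝ × ℝ => dSpace f z.1 z.2)
      = fun z => fderiv ℝ (fun z : ℝ × ℝ => f z.1 z.2) z (1, 0) := by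
    funext z
    have h₁ := (h.contDiff.differentiable (by norm_num) z).hasFDerivAt
    have h₂ : HasDerivAt (fun y : ℝ => (y, z.2)) ((1 : ℝ), (0 : ℝ)) z.1 :=
      (hasDerivAt_id _).prodMk (hasDerivAt_const _ _)
    exact (h₁.comp_hasDerivAt (f := fun y : ℝ => (y, z.2)) z.1 h₂).deriv
  rw [e]
  exact (h.contDiff.continuous_fderiv (by norm_num)).clm_apply continuous_const

lemma memLp (h : IsFactor S f) (t : ℝ) : MemLp (fun y => f y t) 2 (volume.restrict S) := by
  obtain ⟨C, hC⟩ := h.l2_bound |t|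
  exact ⟨(h.contDiff_space t).continuous.aestronglyMeasurable,
    (hC t le_rfl).1.trans_lt ENNReal.coe_lt_top⟩

lemma integrableOn_mul (hf : IsFactor S f) (hg : IsFactor S g) (t : ℝ) :
    IntegrableOn (fun y => f y t * g y t) S :=
  (hf.memLp t).integrable_mul (hg.memLp t)

lemma tendsto_atBot (h : IsFactor (Iic 0) f) (t : ℝ) :
    Tendsto (fun y => f y t) atBot (𝓝 0) ∧ Tendsto (fun y => dSpace f y t) atBot (𝓝 0) := by
  obtain ⟨C, hC⟩ := h.l2_bound |t|
  have hc : Continuous fun y => dSpace (dSpace f) y t := h.continuous_second.comp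
    (by fun_prop : Continuous fun y : ℝ => (y, t))
  exact ⟨(decay_Iic (h.hasDerivAt_space · t) (h.contDiff_dSpace t).continuous
      (hC t le_rfl).1 (hC t le_rfl).2.1).1,
    (decay_Iic (h.hasDerivAt_dSpace · t) hc (hC t le_rfl).2.1 (hC t le_rfl).2.2).1⟩

lemma tendsto_atTop (h : IsFactor (Ici 0) f) (t : ℝ) :
    Tendsto (fun y => f y t) atTop (𝓝 0) ∧ Tendsto (fun y => dSpace f y t) atTop (𝓝 0) := by
  obtain ⟨C, hC⟩ := h.l2_bound |t|
  have hc : Continuous fun y => dSpace (dSpace f) y t := h.continuous_second.comp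
    (by fun_prop : Continuous fun y : ℝ => (y, t))
  exact ⟨(decay_Ici (h.hasDerivAt_space · t) (h.contDiff_dSpace t).continuous
      (hC t le_rfl).1 (hC t le_rfl).2.1).1,
    (decay_Ici (h.hasDerivAt_dSpace · t) hc (hC t le_rfl).2.1 (hC t le_rfl).2.2).1⟩

lemma bounded_Iic (h : IsFactor (Iic 0) f) (T : ℝ) :
    ∃ C : ℝ, 0 ≤ C ∧ ∀ y t, y ≤ 0 → |t| ≤ T → ‖f y t‖ ≤ C ∧ ‖dSpace f y t‖ ≤ C := by
  obtain ⟨C, hC⟩ := h.l2_bound T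
  refine ⟨2 * C, by positivity, fun y t hy ht => ?_⟩
  have hc : Continuous fun y => dSpace (dSpace f) y t := h.continuous_second.comp
    (by fun_prop : Continuous fun y : ℝ => (y, t))
  exact ⟨(decay_Iic (h.hasDerivAt_space · t) (h.contDiff_dSpace t).continuous
      (hC t ht).1 (hC t ht).2.1).2 y hy,
    (decay_Iic (h.hasDerivAt_dSpace · t) hc (hC t ht).2.1 (hC t ht).2.2).2 y hy⟩

lemma bounded_Ici (h : IsFactor (Ici 0) f) (T : ℝ) :
    ∃ C : ℝ, 0 ≤ C ∧ ∀ y t, 0 ≤ y → |t| ≤ T → ‖f y t‖ ≤ C ∧ ‖dSpace f y t‖ ≤ C := by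
  obtain ⟨C, hC⟩ := h.l2_bound T
  refine ⟨2 * C, by positivity, fun y t hy ht => ?_⟩
  have hc : Continuous fun y => dSpace (dSpace f) y t := h.continuous_second.comp
    (by fun_prop : Continuous fun y : ℝ => (y, t))
  exact ⟨(decay_Ici (h.hasDerivAt_space · t) (h.contDiff_dSpace t).continuous
      (hC t ht).1 (hC t ht).2.1).2 y hy,
    (decay_Ici (h.hasDerivAt_dSpace · t) hc (hC t ht).2.1 (hC t ht).2.2).2 y hy⟩

end IsFactor

/-! ### Integrals of products of factors -/

/-- The flux of the density `f g` when `f` solves `f_t = c f' + κ f''` and `g` solves the adjoint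
equation `g_t = c g' - κ g''`. -/
noncomputable def flux (c κ : ℂ) (f g : ℝ → ℝ → ℂ) (y t : ℝ) : ℂ :=
  c * (f y t * g y t) + κ * (dSpace f y t * g y t - f y t * dSpace g y t)

section flux

variable {c κ : ℂ} {f g : ℝ → ℝ → ℂ} {S : Set ℝ}

lemma norm_flux_le {C : ℝ} {y t : ℝ} (hf : ‖f y t‖ ≤ C ∧ ‖dSpace f y t‖ ≤ C)
    (hg : ‖g y t‖ ≤ C ∧ ‖dSpace g y t‖ ≤ C) :
    ‖flux c κ f g y t‖ ≤ ‖c‖ * (C * C) + ‖κ‖ * (C * C + C * C) := by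
  have hC : 0 ≤ C := (norm_nonneg _).trans hf.1
  refine (norm_add_le _ _).trans ?_
  rw [norm_mul, norm_mul κ]
  gcongr
  · rw [norm_mul]; gcongr; exacts [hf.1, hg.1]
  · refine (norm_sub_le _ _).trans ?_
    rw [norm_mul, norm_mul]; gcongr
    exacts [hf.2, hg.1, hf.1, hg.2]

lemma continuous_flux (hf : IsFactor S f) (hg : IsFactor S g) :
    Continuous fun z : ℝ × ℝ => flux c κ f g z.1 z.2 := by
  have := hf.continuous
  have := hg.continuous
  have := hf.continuous_dSpace
  have := hg.continuous_dSpace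
  unfold flux
  fun_prop

lemma tendsto_flux {l : Filter ℝ} {t : ℝ}
    (hf : Tendsto (fun y => f y t) l (𝓝 0) ∧ Tendsto (fun y => dSpace f y t) l (𝓝 0))
    (hg : Tendsto (fun y => g y t) l (𝓝 0) ∧ Tendsto (fun y => dSpace g y t) l (𝓝 0)) :
    Tendsto (fun y => flux c κ f g y t) l (𝓝 0) := by
  have := ((hf.1.mul hg.1).const_mul c).add (((hf.2.mul hg.1).sub (hf.1.mul hg.2)).const_mul κ)
  simpa [flux] using this

/-- The conservation law of the density `f g`: the terms with `f' g'` cancel. -/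
lemma hasDerivAt_flux (hf : IsFactor S f) (hg : IsFactor S g)
    (ef : ∀ y t, dTime f y t = c * dSpace f y t + κ * dSpace (dSpace f) y t)
    (eg : ∀ y t, dTime g y t = c * dSpace g y t - κ * dSpace (dSpace g) y t) (y t : ℝ) :
    HasDerivAt (fun y => flux c κ f g y t) (dTime f y t * g y t + f y t * dTime g y t) y := by
  have f₀ := hf.hasDerivAt_space y t
  have g₀ := hg.hasDerivAt_space y t
  have f₁ := hf.hasDerivAt_dSpace y t
  have g₁ := hg.hasDerivAt_dSpace y t
  refine (((f₀.mul g₀).const_mul c).add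
    (((f₁.mul g₀).sub (f₀.mul g₁)).const_mul κ)).congr_deriv ?_
  rw [ef, eg]; ring

lemma continuous_dTime (hf : IsFactor S f)
    (ef : ∀ y t, dTime f y t = c * dSpace f y t + κ * dSpace (dSpace f) y t) :
    Continuous fun z : ℝ × ℝ => dTime f z.1 z.2 := by
  have := hf.continuous_dSpace
  have := hf.continuous_second
  simp only [ef]
  fun_prop

/-- The boundary term at `-∞` vanishes, so only the flux through `r` contributes. -/
lemma hasDerivAt_time_integral_Iic (hf : IsFactor (Iic 0) f) (hg : IsFactor (Iic 0) g)
    (ef : ∀ y t, dTime f y t = c * dSpace f y t + κ * dSpace (dSpace f) y t)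
    (eg : ∀ y t, dTime g y t = c * dSpace g y t - κ * dSpace (dSpace g) y t) (r t : ℝ) :
    HasDerivAt (fun t => ∫ y in Iic r, f y t * g y t) (flux c κ f g r t) t := by
  have c₁ := hf.continuous
  have c₂ := hg.continuous
  have c₃ := continuous_dTime hf ef
  have c₄ := continuous_dTime (κ := -κ) hg (by simpa [sub_eq_add_neg] using eg)
  refine hasDerivAt_integral_Iic_of_conservation (c₁.mul c₂)
    ((c₃.mul c₂).add (c₁.mul c₄)) (continuous_flux hf hg)
    (fun s t => (hf.hasDerivAt_time s t).mul (hg.hasDerivAt_time s t))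
    (hasDerivAt_flux hf hg ef eg) (hf.integrableOn_mul hg)
    (fun t => tendsto_flux (hf.tendsto_atBot t) (hg.tendsto_atBot t)) (fun T => ?_) r t
  obtain ⟨C, hC, h₁⟩ := hf.bounded_Iic T
  obtain ⟨C', hC', h₂⟩ := hg.bounded_Iic T
  refine ⟨_, fun s t hs ht => norm_flux_le (C := C + C') ?_ ?_⟩
  · exact ⟨by linarith [(h₁ s t hs ht).1], by linarith [(h₁ s t hs ht).2]⟩
  · exact ⟨by linarith [(h₂ s t hs ht).1], by linarith [(h₂ s t hs ht).2]⟩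

lemma hasDerivAt_time_integral_Ici (hf : IsFactor (Ici 0) f) (hg : IsFactor (Ici 0) g)
    (ef : ∀ y t, dTime f y t = c * dSpace f y t + κ * dSpace (dSpace f) y t)
    (eg : ∀ y t, dTime g y t = c * dSpace g y t - κ * dSpace (dSpace g) y t) (r t : ℝ) :
    HasDerivAt (fun t => ∫ y in Ici r, f y t * g y t) (-flux c κ f g r t) t := by
  have c₁ := hf.continuous
  have c₂ := hg.continuous
  have c₃ := continuous_dTime hf ef
  have c₄ := continuous_dTime (κ := -κ) hg (by simpa [sub_eq_add_neg] using eg)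
  refine hasDerivAt_integral_Ici_of_conservation (c₁.mul c₂)
    ((c₃.mul c₂).add (c₁.mul c₄)) (continuous_flux hf hg)
    (fun s t => (hf.hasDerivAt_time s t).mul (hg.hasDerivAt_time s t))
    (hasDerivAt_flux hf hg ef eg) (hf.integrableOn_mul hg)
    (fun t => tendsto_flux (hf.tendsto_atTop t) (hg.tendsto_atTop t)) (fun T => ?_) r t
  obtain ⟨C, hC, h₁⟩ := hf.bounded_Ici T
  obtain ⟨C', hC', h₂⟩ := hg.bounded_Ici T
  refine ⟨_, fun s t hs ht => norm_flux_le (C := C + C') ?_ ?_⟩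
  · exact ⟨by linarith [(h₁ s t hs ht).1], by linarith [(h₁ s t hs ht).2]⟩
  · exact ⟨by linarith [(h₂ s t hs ht).1], by linarith [(h₂ s t hs ht).2]⟩

end flux

/-! ### Two-by-two resolvents -/

noncomputable section

/-- `det (1 - m a)` for the diagonal matrix `a` and the matrix `m`. -/
def resDet (a : Fin 2 → ℂ) (m : Fin 2 → Fin 2 → ℂ) : ℂ :=
  1 - a 0 * m 0 0 - a 1 * m 1 1 + a 0 * m 0 0 * a 1 * m 1 1 - a 1 * m 1 0 * a 0 * m 0 1

/-- The inverse of `1 - m a`, where `a` is diagonal. -/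
def resR (a : Fin 2 → ℂ) (m : Fin 2 → Fin 2 → ℂ) : Fin 2 → Fin 2 → ℂ :=
  ![![(1 - a 1 * m 1 1) / resDet a m, a 1 * m 0 1 / resDet a m],
    ![a 0 * m 1 0 / resDet a m, (1 - a 0 * m 0 0) / resDet a m]]

/-- The inverse of `1 - a m`, where `a` is diagonal. -/
def resN (a : Fin 2 → ℂ) (m : Fin 2 → Fin 2 → ℂ) : Fin 2 → Fin 2 → ℂ :=
  ![![(1 - a 1 * m 1 1) / resDet a m, a 0 * m 0 1 / resDet a m],
    ![a 1 * m 1 0 / resDet a m, (1 - a 0 * m 0 0) / resDet a m]]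

/-- The matrix `a (1 - m a)⁻¹ = (1 - a m)⁻¹ a`. -/
def resX (a : Fin 2 → ℂ) (m : Fin 2 → Fin 2 → ℂ) (i j : Fin 2) : ℂ := a i * resR a m i j

/-- The matrix `(1 - m a)⁻¹ m = m (1 - a m)⁻¹`. -/
def resY (a : Fin 2 → ℂ) (m : Fin 2 → Fin 2 → ℂ) (i j : Fin 2) : ℂ := ∑ l, resR a m i l * m l j

/-- The column `(1 - m a)⁻¹ u`. -/
def resCol (a : Fin 2 → ℂ) (m : Fin 2 → Fin 2 → ℂ) (u : Fin 2 → ℂ) (k : Fin 2) : ℂ :=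
  ∑ j, resR a m k j * u j

/-- The row `v (1 - a m)⁻¹`. -/
def resRow (a : Fin 2 → ℂ) (m : Fin 2 → Fin 2 → ℂ) (v : Fin 2 → ℂ) (k : Fin 2) : ℂ :=
  ∑ j, v j * resN a m j k

/-- The scalar `v a (1 - m a)⁻¹ u`. -/
def resForm (a : Fin 2 → ℂ) (m : Fin 2 → Fin 2 → ℂ) (v u : Fin 2 → ℂ) : ℂ :=
  ∑ i, ∑ j, v i * resX a m i j * u j

/-- `(1 - a m)⁻¹ = 1 + a (1 - m a)⁻¹ m`. -/
lemma resN_eq {a : Fin 2 → ℂ} {m : Fin 2 → Fin 2 → ℂ} (h : resDet a m ≠ 0) (i j : Fin 2) :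
    resN a m i j = (if i = j then 1 else 0) + a i * resY a m i j := by
  fin_cases i <;> fin_cases j <;> simp [resN, resY, resR, Fin.sum_univ_two] <;> field_simp <;>
    (try simp only [resDet]) <;> ring

section limits

variable {E : Type*} {l : Filter E} {a : E → Fin 2 → ℂ} {m : E → Fin 2 → Fin 2 → ℂ}
  {u v : E → Fin 2 → ℂ} {a₀ : Fin 2 → ℂ} {m₀ : Fin 2 → Fin 2 → ℂ} {u₀ v₀ : Fin 2 → ℂ}

lemma tendsto_resDet (ha : ∀ k, Tendsto (fun e => a e k) l (𝓝 (a₀ k)))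
    (hm : ∀ i j, Tendsto (fun e => m e i j) l (𝓝 (m₀ i j))) :
    Tendsto (fun e => resDet (a e) (m e)) l (𝓝 (resDet a₀ m₀)) :=
  ((((tendsto_const_nhds.sub ((ha 0).mul (hm 0 0))).sub ((ha 1).mul (hm 1 1))).add
    ((((ha 0).mul (hm 0 0)).mul (ha 1)).mul (hm 1 1))).sub
    ((((ha 1).mul (hm 1 0)).mul (ha 0)).mul (hm 0 1)))

lemma tendsto_resR (ha : ∀ k, Tendsto (fun e => a e k) l (𝓝 (a₀ k)))
    (hm : ∀ i j, Tendsto (fun e => m e i j) l (𝓝 (m₀ i j))) (h : resDet a₀ m₀ ≠ 0) (i j : Fin 2) :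
    Tendsto (fun e => resR (a e) (m e) i j) l (𝓝 (resR a₀ m₀ i j)) := by
  have hd := tendsto_resDet ha hm
  fin_cases i <;> fin_cases j
  · exact (tendsto_const_nhds.sub ((ha 1).mul (hm 1 1))).div hd h
  · exact ((ha 1).mul (hm 0 1)).div hd h
  · exact ((ha 0).mul (hm 1 0)).div hd h
  · exact (tendsto_const_nhds.sub ((ha 0).mul (hm 0 0))).div hd h

lemma tendsto_resN (ha : ∀ k, Tendsto (fun e => a e k) l (𝓝 (a₀ k)))
    (hm : ∀ i j, Tendsto (fun e => m e i j) l (𝓝 (m₀ i j))) (h : resDet a₀ m₀ ≠ 0) (i j : Fin 2) :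
    Tendsto (fun e => resN (a e) (m e) i j) l (𝓝 (resN a₀ m₀ i j)) := by
  have hd := tendsto_resDet ha hm
  fin_cases i <;> fin_cases j
  · exact (tendsto_const_nhds.sub ((ha 1).mul (hm 1 1))).div hd h
  · exact ((ha 0).mul (hm 0 1)).div hd h
  · exact ((ha 1).mul (hm 1 0)).div hd h
  · exact (tendsto_const_nhds.sub ((ha 0).mul (hm 0 0))).div hd h

lemma tendsto_resY (ha : ∀ k, Tendsto (fun e => a e k) l (𝓝 (a₀ k)))
    (hm : ∀ i j, Tendsto (fun e => m e i j) l (𝓝 (m₀ i j))) (h : resDet a₀ m₀ ≠ 0) (i j : Fin 2) :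
    Tendsto (fun e => resY (a e) (m e) i j) l (𝓝 (resY a₀ m₀ i j)) :=
  tendsto_finsetSum _ fun k _ => (tendsto_resR ha hm h i k).mul (hm k j)

lemma tendsto_resCol (ha : ∀ k, Tendsto (fun e => a e k) l (𝓝 (a₀ k)))
    (hm : ∀ i j, Tendsto (fun e => m e i j) l (𝓝 (m₀ i j))) (h : resDet a₀ m₀ ≠ 0)
    (hu : ∀ k, Tendsto (fun e => u e k) l (𝓝 (u₀ k))) (k : Fin 2) :
    Tendsto (fun e => resCol (a e) (m e) (u e) k) l (𝓝 (resCol a₀ m₀ u₀ k)) :=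
  tendsto_finsetSum _ fun j _ => (tendsto_resR ha hm h k j).mul (hu j)

lemma tendsto_resRow (ha : ∀ k, Tendsto (fun e => a e k) l (𝓝 (a₀ k)))
    (hm : ∀ i j, Tendsto (fun e => m e i j) l (𝓝 (m₀ i j))) (h : resDet a₀ m₀ ≠ 0)
    (hv : ∀ k, Tendsto (fun e => v e k) l (𝓝 (v₀ k))) (k : Fin 2) :
    Tendsto (fun e => resRow (a e) (m e) (v e) k) l (𝓝 (resRow a₀ m₀ v₀ k)) :=
  tendsto_finsetSum _ fun j _ => (hv j).mul (tendsto_resN ha hm h j k)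

lemma tendsto_resForm (ha : ∀ k, Tendsto (fun e => a e k) l (𝓝 (a₀ k)))
    (hm : ∀ i j, Tendsto (fun e => m e i j) l (𝓝 (m₀ i j))) (h : resDet a₀ m₀ ≠ 0)
    (hv : ∀ k, Tendsto (fun e => v e k) l (𝓝 (v₀ k)))
    (hu : ∀ k, Tendsto (fun e => u e k) l (𝓝 (u₀ k))) :
    Tendsto (fun e => resForm (a e) (m e) (v e) (u e)) l (𝓝 (resForm a₀ m₀ v₀ u₀)) :=
  tendsto_finsetSum _ fun i _ => tendsto_finsetSum _ fun j _ =>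
    ((hv i).mul ((ha i).mul (tendsto_resR ha hm h i j))).mul (hu j)

end limits

section smoothness

variable {E : Type*} [NormedAddCommGroup E] [NormedSpace ℝ E] {n : WithTop ℕ∞} {e : E}
  {a : E → Fin 2 → ℂ} {m : E → Fin 2 → Fin 2 → ℂ} {u v : E → Fin 2 → ℂ}

lemma contDiffAt_resDet (ha : ∀ k, ContDiffAt ℝ n (fun e => a e k) e)
    (hm : ∀ i j, ContDiffAt ℝ n (fun e => m e i j) e) :
    ContDiffAt ℝ n (fun e => resDet (a e) (m e)) e :=
  ((((contDiffAt_const.sub ((ha 0).mul (hm 0 0))).sub ((ha 1).mul (hm 1 1))).add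
    ((((ha 0).mul (hm 0 0)).mul (ha 1)).mul (hm 1 1))).sub
    ((((ha 1).mul (hm 1 0)).mul (ha 0)).mul (hm 0 1)))

lemma contDiffAt_resR (ha : ∀ k, ContDiffAt ℝ n (fun e => a e k) e)
    (hm : ∀ i j, ContDiffAt ℝ n (fun e => m e i j) e) (h : resDet (a e) (m e) ≠ 0) (i j : Fin 2) :
    ContDiffAt ℝ n (fun e => resR (a e) (m e) i j) e := by
  have hd := (contDiffAt_resDet ha hm).inv h
  fin_cases i <;> fin_cases j
  · exact (contDiffAt_const.sub ((ha 1).mul (hm 1 1))).mul hd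
  · exact ((ha 1).mul (hm 0 1)).mul hd
  · exact ((ha 0).mul (hm 1 0)).mul hd
  · exact (contDiffAt_const.sub ((ha 0).mul (hm 0 0))).mul hd

lemma contDiffAt_resN (ha : ∀ k, ContDiffAt ℝ n (fun e => a e k) e)
    (hm : ∀ i j, ContDiffAt ℝ n (fun e => m e i j) e) (h : resDet (a e) (m e) ≠ 0) (i j : Fin 2) :
    ContDiffAt ℝ n (fun e => resN (a e) (m e) i j) e := by
  have hd := (contDiffAt_resDet ha hm).inv h
  fin_cases i <;> fin_cases j
  · exact (contDiffAt_const.sub ((ha 1).mul (hm 1 1))).mul hd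
  · exact ((ha 0).mul (hm 0 1)).mul hd
  · exact ((ha 1).mul (hm 1 0)).mul hd
  · exact (contDiffAt_const.sub ((ha 0).mul (hm 0 0))).mul hd

lemma contDiffAt_resY (ha : ∀ k, ContDiffAt ℝ n (fun e => a e k) e)
    (hm : ∀ i j, ContDiffAt ℝ n (fun e => m e i j) e) (h : resDet (a e) (m e) ≠ 0) (i j : Fin 2) :
    ContDiffAt ℝ n (fun e => resY (a e) (m e) i j) e :=
  ContDiffAt.sum fun k _ => (contDiffAt_resR ha hm h i k).mul (hm k j)

lemma contDiffAt_resCol (ha : ∀ k, ContDiffAt ℝ n (fun e => a e k) e)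
    (hm : ∀ i j, ContDiffAt ℝ n (fun e => m e i j) e) (h : resDet (a e) (m e) ≠ 0)
    (hu : ∀ k, ContDiffAt ℝ n (fun e => u e k) e) (k : Fin 2) :
    ContDiffAt ℝ n (fun e => resCol (a e) (m e) (u e) k) e :=
  ContDiffAt.sum fun j _ => (contDiffAt_resR ha hm h k j).mul (hu j)

lemma contDiffAt_resRow (ha : ∀ k, ContDiffAt ℝ n (fun e => a e k) e)
    (hm : ∀ i j, ContDiffAt ℝ n (fun e => m e i j) e) (h : resDet (a e) (m e) ≠ 0)
    (hv : ∀ k, ContDiffAt ℝ n (fun e => v e k) e) (k : Fin 2) :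
    ContDiffAt ℝ n (fun e => resRow (a e) (m e) (v e) k) e :=
  ContDiffAt.sum fun j _ => (hv j).mul (contDiffAt_resN ha hm h j k)

lemma contDiffAt_resForm (ha : ∀ k, ContDiffAt ℝ n (fun e => a e k) e)
    (hm : ∀ i j, ContDiffAt ℝ n (fun e => m e i j) e) (h : resDet (a e) (m e) ≠ 0)
    (hv : ∀ k, ContDiffAt ℝ n (fun e => v e k) e) (hu : ∀ k, ContDiffAt ℝ n (fun e => u e k) e) :
    ContDiffAt ℝ n (fun e => resForm (a e) (m e) (v e) (u e)) e :=
  ContDiffAt.sum fun i _ => ContDiffAt.sum fun j _ =>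
    ((hv i).mul ((ha i).mul (contDiffAt_resR ha hm h i j))).mul (hu j)

end smoothness

section derivatives

variable {τ : ℝ} {a : ℝ → Fin 2 → ℂ} {m : ℝ → Fin 2 → Fin 2 → ℂ} {u v : ℝ → Fin 2 → ℂ}
  {a' : Fin 2 → ℂ} {m' : Fin 2 → Fin 2 → ℂ} {u' v' : Fin 2 → ℂ}

lemma hasDerivAt_resDet (ha : ∀ k, HasDerivAt (fun τ => a τ k) (a' k) τ)
    (hm : ∀ i j, HasDerivAt (fun τ => m τ i j) (m' i j) τ) :
    HasDerivAt (fun τ => resDet (a τ) (m τ))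
      (-a' 0 * m τ 0 0 - a τ 0 * m' 0 0 - a' 1 * m τ 1 1 - a τ 1 * m' 1 1
        + (a' 0 * a τ 1 + a τ 0 * a' 1) * (m τ 0 0 * m τ 1 1 - m τ 1 0 * m τ 0 1)
        + a τ 0 * a τ 1 * (m' 0 0 * m τ 1 1 + m τ 0 0 * m' 1 1
          - m' 1 0 * m τ 0 1 - m τ 1 0 * m' 0 1)) τ := by
  refine (((((hasDerivAt_const τ (1:ℂ)).sub ((ha 0).mul (hm 0 0))).sub ((ha 1).mul (hm 1 1))).add
    ((((ha 0).mul (hm 0 0)).mul (ha 1)).mul (hm 1 1))).sub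
    ((((ha 1).mul (hm 1 0)).mul (ha 0)).mul (hm 0 1))).congr_deriv ?_
  simp only [Pi.mul_apply]
  ring

/-- `d(1 - m a)⁻¹ = R (dm) X + Y (da) R`. -/
lemma hasDerivAt_resR (ha : ∀ k, HasDerivAt (fun τ => a τ k) (a' k) τ)
    (hm : ∀ i j, HasDerivAt (fun τ => m τ i j) (m' i j) τ) (h : resDet (a τ) (m τ) ≠ 0)
    (i j : Fin 2) :
    HasDerivAt (fun τ => resR (a τ) (m τ) i j)
      (∑ k, ∑ l, resR (a τ) (m τ) i k * m' k l * resX (a τ) (m τ) l j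
        + ∑ k, resY (a τ) (m τ) i k * a' k * resR (a τ) (m τ) k j) τ := by
  have hd := hasDerivAt_resDet ha hm
  have key : ∀ (c : ℝ → ℂ) (c' D' : ℂ), HasDerivAt c c' τ →
      HasDerivAt (fun τ => resDet (a τ) (m τ)) D' τ → ∀ V : ℂ,
      c' * resDet (a τ) (m τ) - c τ * D' = V * resDet (a τ) (m τ) ^ 2 →
      HasDerivAt (fun τ => c τ / resDet (a τ) (m τ)) V τ := by
    intro c c' D' hc hD V hV
    refine (hc.fun_div hD h).congr_deriv ?_
    rw [hV]; field_simp
  fin_cases i <;> fin_cases j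
  · refine key _ _ _ ((hasDerivAt_const τ (1:ℂ)).sub ((ha 1).mul (hm 1 1))) hd _ ?_
    simp [Fin.sum_univ_two, resX, resY, resR]
    field_simp
    simp only [resDet]
    ring
  · refine key _ _ _ ((ha 1).mul (hm 0 1)) hd _ ?_
    simp [Fin.sum_univ_two, resX, resY, resR]
    field_simp
    simp only [resDet]
    ring
  · refine key _ _ _ ((ha 0).mul (hm 1 0)) hd _ ?_
    simp [Fin.sum_univ_two, resX, resY, resR]
    field_simp
    simp only [resDet]
    ring
  · refine key _ _ _ ((hasDerivAt_const τ (1:ℂ)).sub ((ha 0).mul (hm 0 0))) hd _ ?_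
    simp [Fin.sum_univ_two, resX, resY, resR]
    field_simp
    simp only [resDet]
    ring

/-- `dY = R (dm) N + Y (da) Y`. -/
lemma hasDerivAt_resY (ha : ∀ k, HasDerivAt (fun τ => a τ k) (a' k) τ)
    (hm : ∀ i j, HasDerivAt (fun τ => m τ i j) (m' i j) τ) (h : resDet (a τ) (m τ) ≠ 0)
    (i j : Fin 2) :
    HasDerivAt (fun τ => resY (a τ) (m τ) i j)
      (∑ k, ∑ l, resR (a τ) (m τ) i k * m' k l * resN (a τ) (m τ) l j
        + ∑ k, resY (a τ) (m τ) i k * a' k * resY (a τ) (m τ) k j) τ := by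
  refine (HasDerivAt.fun_sum fun l (_ : l ∈ Finset.univ) =>
    (hasDerivAt_resR ha hm h i l).mul (hm l j)).congr_deriv ?_
  have := resN_eq h
  fin_cases j <;> simp [Fin.sum_univ_two, this, resX, resY] <;> ring

/-- `dX = X (dm) X + N (da) R`. -/
lemma hasDerivAt_resX (ha : ∀ k, HasDerivAt (fun τ => a τ k) (a' k) τ)
    (hm : ∀ i j, HasDerivAt (fun τ => m τ i j) (m' i j) τ) (h : resDet (a τ) (m τ) ≠ 0)
    (i j : Fin 2) :
    HasDerivAt (fun τ => resX (a τ) (m τ) i j)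
      (∑ k, ∑ l, resX (a τ) (m τ) i k * m' k l * resX (a τ) (m τ) l j
        + ∑ k, resN (a τ) (m τ) i k * a' k * resR (a τ) (m τ) k j) τ := by
  refine ((ha i).fun_mul (hasDerivAt_resR ha hm h i j)).congr_deriv ?_
  have := resN_eq h
  fin_cases i <;> simp [Fin.sum_univ_two, this, resX] <;> ring

/-- `d(1 - a m)⁻¹ = X (dm) N + N (da) Y`. -/
lemma hasDerivAt_resN (ha : ∀ k, HasDerivAt (fun τ => a τ k) (a' k) τ)
    (hm : ∀ i j, HasDerivAt (fun τ => m τ i j) (m' i j) τ) (h : resDet (a τ) (m τ) ≠ 0)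
    (i j : Fin 2) :
    HasDerivAt (fun τ => resN (a τ) (m τ) i j)
      (∑ k, ∑ l, resX (a τ) (m τ) i k * m' k l * resN (a τ) (m τ) l j
        + ∑ k, resN (a τ) (m τ) i k * a' k * resY (a τ) (m τ) k j) τ := by
  have hne : ∀ᶠ s in 𝓝 τ, resDet (a s) (m s) ≠ 0 :=
    (hasDerivAt_resDet ha hm).continuousAt.eventually_ne h
  have e : (fun s => resN (a s) (m s) i j)
      =ᶠ[𝓝 τ] fun s => (if i = j then 1 else 0) + a s i * resY (a s) (m s) i j :=
    hne.mono fun s hs => resN_eq hs i j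
  refine HasDerivAt.congr_of_eventuallyEq ?_ e
  refine (((ha i).fun_mul (hasDerivAt_resY ha hm h i j)).const_add _).congr_deriv ?_
  have := resN_eq h
  fin_cases i <;> fin_cases j <;> simp [Fin.sum_univ_two, this, resX] <;> ring

lemma hasDerivAt_resCol (ha : ∀ k, HasDerivAt (fun τ => a τ k) (a' k) τ)
    (hm : ∀ i j, HasDerivAt (fun τ => m τ i j) (m' i j) τ) (h : resDet (a τ) (m τ) ≠ 0)
    (hu : ∀ k, HasDerivAt (fun τ => u τ k) (u' k) τ) (k : Fin 2) :
    HasDerivAt (fun τ => resCol (a τ) (m τ) (u τ) k)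
      (∑ i, ∑ j, ∑ l, resR (a τ) (m τ) k i * m' i j * resX (a τ) (m τ) j l * u τ l
        + ∑ l, resY (a τ) (m τ) k l * a' l * resCol (a τ) (m τ) (u τ) l
        + resCol (a τ) (m τ) u' k) τ := by
  refine (HasDerivAt.fun_sum fun l (_ : l ∈ Finset.univ) =>
    (hasDerivAt_resR ha hm h k l).mul (hu l)).congr_deriv ?_
  simp only [Fin.sum_univ_two, resCol]
  ring

lemma hasDerivAt_resRow (ha : ∀ k, HasDerivAt (fun τ => a τ k) (a' k) τ)
    (hm : ∀ i j, HasDerivAt (fun τ => m τ i j) (m' i j) τ) (h : resDet (a τ) (m τ) ≠ 0)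
    (hv : ∀ k, HasDerivAt (fun τ => v τ k) (v' k) τ) (k : Fin 2) :
    HasDerivAt (fun τ => resRow (a τ) (m τ) (v τ) k)
      (∑ l, ∑ i, ∑ j, v τ l * resX (a τ) (m τ) l i * m' i j * resN (a τ) (m τ) j k
        + ∑ l, resRow (a τ) (m τ) (v τ) l * a' l * resY (a τ) (m τ) l k
        + resRow (a τ) (m τ) v' k) τ := by
  refine (HasDerivAt.fun_sum fun l (_ : l ∈ Finset.univ) =>
    (hv l).mul (hasDerivAt_resN ha hm h l k)).congr_deriv ?_
  simp only [Fin.sum_univ_two, resRow]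
  ring

lemma hasDerivAt_resForm (ha : ∀ k, HasDerivAt (fun τ => a τ k) (a' k) τ)
    (hm : ∀ i j, HasDerivAt (fun τ => m τ i j) (m' i j) τ) (h : resDet (a τ) (m τ) ≠ 0)
    (hv : ∀ k, HasDerivAt (fun τ => v τ k) (v' k) τ)
    (hu : ∀ k, HasDerivAt (fun τ => u τ k) (u' k) τ) :
    HasDerivAt (fun τ => resForm (a τ) (m τ) (v τ) (u τ))
      (∑ k, ∑ i, ∑ j, ∑ l,
          v τ k * resX (a τ) (m τ) k i * m' i j * resX (a τ) (m τ) j l * u τ l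
        + ∑ l, resRow (a τ) (m τ) (v τ) l * a' l * resCol (a τ) (m τ) (u τ) l
        + resForm (a τ) (m τ) v' (u τ) + resForm (a τ) (m τ) (v τ) u') τ := by
  refine (HasDerivAt.fun_sum fun k (_ : k ∈ Finset.univ) =>
    HasDerivAt.fun_sum fun l (_ : l ∈ Finset.univ) =>
    ((hv k).mul (hasDerivAt_resX ha hm h k l)).mul (hu l)).congr_deriv ?_
  simp only [Fin.sum_univ_two, resForm, resRow, resCol, Pi.mul_apply]
  ring

/-! In the space directions `dM` has rank one, so that the terms with `dM` factor through the
columns `R u`, the rows `v N` and the scalars `v X u`; in the time direction `dM` is a combination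
of such terms. -/

section rankOne

variable {ρ σ : ℂ} {d φ γ φ₁ φ₂ γ₁ γ₂ u₁ v₁ : Fin 2 → ℂ}

lemma hasDerivAt_resY_rankOne (ha : ∀ k, HasDerivAt (fun τ => a τ k) (ρ * d k) τ)
    (hm : ∀ i j, HasDerivAt (fun τ => m τ i j) (-σ * (φ i * γ j)) τ) (h : resDet (a τ) (m τ) ≠ 0)
    (i j : Fin 2) :
    HasDerivAt (fun τ => resY (a τ) (m τ) i j)
      (ρ * ∑ l, resY (a τ) (m τ) i l * d l * resY (a τ) (m τ) l j
        - σ * (resCol (a τ) (m τ) φ i * resRow (a τ) (m τ) γ j)) τ := by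
  refine (hasDerivAt_resY ha hm h i j).congr_deriv ?_
  simp only [Fin.sum_univ_two, resCol, resRow]
  ring

lemma hasDerivAt_resCol_rankOne (ha : ∀ k, HasDerivAt (fun τ => a τ k) (ρ * d k) τ)
    (hm : ∀ i j, HasDerivAt (fun τ => m τ i j) (-σ * (φ i * γ j)) τ) (h : resDet (a τ) (m τ) ≠ 0)
    (hu : ∀ k, HasDerivAt (fun τ => u τ k) (σ * u₁ k) τ) (k : Fin 2) :
    HasDerivAt (fun τ => resCol (a τ) (m τ) (u τ) k)
      (ρ * ∑ l, resY (a τ) (m τ) k l * d l * resCol (a τ) (m τ) (u τ) l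
        + σ * (resCol (a τ) (m τ) u₁ k
          - resCol (a τ) (m τ) φ k * resForm (a τ) (m τ) γ (u τ))) τ := by
  refine (hasDerivAt_resCol ha hm h hu k).congr_deriv ?_
  simp only [Fin.sum_univ_two, resCol, resForm]
  ring

lemma hasDerivAt_resRow_rankOne (ha : ∀ k, HasDerivAt (fun τ => a τ k) (ρ * d k) τ)
    (hm : ∀ i j, HasDerivAt (fun τ => m τ i j) (-σ * (φ i * γ j)) τ) (h : resDet (a τ) (m τ) ≠ 0)
    (hv : ∀ k, HasDerivAt (fun τ => v τ k) (σ * v₁ k) τ) (k : Fin 2) :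
    HasDerivAt (fun τ => resRow (a τ) (m τ) (v τ) k)
      (ρ * ∑ l, resRow (a τ) (m τ) (v τ) l * d l * resY (a τ) (m τ) l k
        + σ * (resRow (a τ) (m τ) v₁ k
          - resForm (a τ) (m τ) (v τ) φ * resRow (a τ) (m τ) γ k)) τ := by
  refine (hasDerivAt_resRow ha hm h hv k).congr_deriv ?_
  simp only [Fin.sum_univ_two, resRow, resForm]
  ring

lemma hasDerivAt_resForm_rankOne (ha : ∀ k, HasDerivAt (fun τ => a τ k) (ρ * d k) τ)
    (hm : ∀ i j, HasDerivAt (fun τ => m τ i j) (-σ * (φ i * γ j)) τ) (h : resDet (a τ) (m τ) ≠ 0)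
    (hv : ∀ k, HasDerivAt (fun τ => v τ k) (σ * v₁ k) τ)
    (hu : ∀ k, HasDerivAt (fun τ => u τ k) (σ * u₁ k) τ) :
    HasDerivAt (fun τ => resForm (a τ) (m τ) (v τ) (u τ))
      (ρ * ∑ l, resRow (a τ) (m τ) (v τ) l * d l * resCol (a τ) (m τ) (u τ) l
        + σ * (resForm (a τ) (m τ) v₁ (u τ) + resForm (a τ) (m τ) (v τ) u₁
          - resForm (a τ) (m τ) (v τ) φ * resForm (a τ) (m τ) γ (u τ))) τ := by
  refine (hasDerivAt_resForm ha hm h hv hu).congr_deriv ?_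
  simp only [Fin.sum_univ_two, resForm, resRow, resCol]
  ring

/-- The evolution of the column `R u` when `u` solves `u_t = -c φ₁ + κ φ₂` and `dm` is the flux of
the products of `u` and `v`; here `φ₁`, `φ₂`, `γ₁` stand for `u'`, `u''`, `v'`. -/
lemma hasDerivAt_resCol_flux {c κ : ℂ} (ha : ∀ k, HasDerivAt (fun τ => a τ k) (a' k) τ)
    (hm : ∀ i j, HasDerivAt (fun τ => m τ i j)
      (c * (u τ i * v τ j) + κ * (u τ i * γ₁ j - φ₁ i * v τ j)) τ)
    (h : resDet (a τ) (m τ) ≠ 0)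
    (hu : ∀ k, HasDerivAt (fun τ => u τ k) (-c * φ₁ k + κ * φ₂ k) τ) (k : Fin 2) :
    HasDerivAt (fun τ => resCol (a τ) (m τ) (u τ) k)
      (∑ l, resY (a τ) (m τ) k l * a' l * resCol (a τ) (m τ) (u τ) l
        + c * (resCol (a τ) (m τ) (u τ) k * resForm (a τ) (m τ) (v τ) (u τ)
          - resCol (a τ) (m τ) φ₁ k)
        + κ * (resCol (a τ) (m τ) (u τ) k * resForm (a τ) (m τ) γ₁ (u τ)
          - resCol (a τ) (m τ) φ₁ k * resForm (a τ) (m τ) (v τ) (u τ)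
          + resCol (a τ) (m τ) φ₂ k)) τ := by
  refine (hasDerivAt_resCol ha hm h hu k).congr_deriv ?_
  simp only [Fin.sum_univ_two, resCol, resForm]
  ring

/-- The evolution of the row `v N` when `v` solves `v_t = -c γ₁ - κ γ₂` and `dm` is the flux of
the products of `u` and `v`; here `φ₁`, `γ₁`, `γ₂` stand for `u'`, `v'`, `v''`. -/
lemma hasDerivAt_resRow_flux {c κ : ℂ} (ha : ∀ k, HasDerivAt (fun τ => a τ k) (a' k) τ)
    (hm : ∀ i j, HasDerivAt (fun τ => m τ i j)
      (c * (u τ i * v τ j) + κ * (u τ i * γ₁ j - φ₁ i * v τ j)) τ)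
    (h : resDet (a τ) (m τ) ≠ 0)
    (hv : ∀ k, HasDerivAt (fun τ => v τ k) (-c * γ₁ k - κ * γ₂ k) τ) (k : Fin 2) :
    HasDerivAt (fun τ => resRow (a τ) (m τ) (v τ) k)
      (∑ l, resRow (a τ) (m τ) (v τ) l * a' l * resY (a τ) (m τ) l k
        + c * (resForm (a τ) (m τ) (v τ) (u τ) * resRow (a τ) (m τ) (v τ) k
          - resRow (a τ) (m τ) γ₁ k)
        + κ * (resForm (a τ) (m τ) (v τ) (u τ) * resRow (a τ) (m τ) γ₁ k
          - resForm (a τ) (m τ) (v τ) φ₁ * resRow (a τ) (m τ) (v τ) k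
          - resRow (a τ) (m τ) γ₂ k)) τ := by
  refine (hasDerivAt_resRow ha hm h hv k).congr_deriv ?_
  simp only [Fin.sum_univ_two, resRow, resForm]
  ring

end rankOne

end derivatives
end

/-! ### The potential in characteristic coordinates -/

noncomputable section

/-- Componentwise space derivative. -/
def dSpaceVec (u : Fin 2 → ℝ → ℝ → ℂ) : Fin 2 → ℝ → ℝ → ℂ := fun k => dSpace (u k)

/-- A vector of functions of one space variable, evaluated at the characteristic coordinate
`y + x`. -/
def atSum (u : Fin 2 → ℝ → ℝ → ℂ) (x y t : ℝ) (k : Fin 2) : ℂ := u k (y + x) t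

/-- A vector of functions of one space variable, evaluated at the characteristic coordinate
`y - x`. -/
def atDiff (u : Fin 2 → ℝ → ℝ → ℂ) (x y t : ℝ) (k : Fin 2) : ℂ := u k (y - x) t

namespace DegenerateData

variable (d : DegenerateData)

/-- The first factors of `F₁₂`, integrated towards `-∞`. -/
def fL : Fin 2 → ℝ → ℝ → ℂ := ![d.f₁, d.f₃]

/-- The second factors of `F₁₂`, integrated towards `+∞`. -/
def fR : Fin 2 → ℝ → ℝ → ℂ := ![d.f₂, d.f₄]

/-- The first factors of `G₂₁`, integrated towards `+∞`. -/
def gR : Fin 2 → ℝ → ℝ → ℂ := ![d.g₁, d.g₃]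

/-- The second factors of `G₂₁`, integrated towards `-∞`. -/
def gL : Fin 2 → ℝ → ℝ → ℂ := ![d.g₂, d.g₄]

/-- The diagonal matrix `(α₁₂, α₃₄)`, as a function of `y + x`. -/
def A (x y t : ℝ) (k : Fin 2) : ℂ := ∫ s in Iic (y + x), d.fL k s t * d.gL k s t

/-- The matrix with rows `(α₂₁, α₂₃)` and `(α₄₁, α₄₃)`, as a function of `y - x`. -/
def M (x y t : ℝ) (i j : Fin 2) : ℂ := ∫ s in Ici (y - x), d.fR i s t * d.gR j s t

/-- The column `(1 - M A)⁻¹ u`. -/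
def col (u : Fin 2 → ℝ → ℝ → ℂ) (x y t : ℝ) (k : Fin 2) : ℂ :=
  resCol (d.A x y t) (d.M x y t) (atDiff u x y t) k

/-- The row `v (1 - A M)⁻¹`. -/
def row (v : Fin 2 → ℝ → ℝ → ℂ) (x y t : ℝ) (k : Fin 2) : ℂ :=
  resRow (d.A x y t) (d.M x y t) (atDiff v x y t) k

/-- The scalar `v A (1 - M A)⁻¹ u`. -/
def form (v u : Fin 2 → ℝ → ℝ → ℂ) (x y t : ℝ) : ℂ :=
  resForm (d.A x y t) (d.M x y t) (atDiff v x y t) (atDiff u x y t)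

/-- The matrix `(1 - M A)⁻¹ M`. -/
def Y (x y t : ℝ) (i j : Fin 2) : ℂ := resY (d.A x y t) (d.M x y t) i j

/-- The derivative of `A` with respect to `y + x`. -/
def dA (x y t : ℝ) (k : Fin 2) : ℂ := atSum d.fL x y t k * atSum d.gL x y t k

/-! ### The explicit kernels as resolvents -/

lemma setIntegral_Iic_comp_add (h : ℝ → ℂ) (x y : ℝ) :
    ∫ s in Iic y, h (s + x) = ∫ s in Iic (y + x), h s := by
  have e := (measurePreserving_add_right (volume : Measure ℝ) x).setIntegral_preimage_emb
    (measurableEmbedding_addRight x) h (Iic (y + x))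
  have hp : (fun s => s + x) ⁻¹' Iic (y + x) = Iic y := by ext; simp
  rw [← e, hp]

lemma setIntegral_Ici_comp_sub (h : ℝ → ℂ) (x y : ℝ) :
    ∫ s in Ici y, h (s - x) = ∫ s in Ici (y - x), h s := by
  have e := (measurePreserving_add_right (volume : Measure ℝ) (-x)).setIntegral_preimage_emb
    (measurableEmbedding_addRight (-x)) h (Ici (y - x))
  have hp : (fun s => s + -x) ⁻¹' Ici (y - x) = Ici y := by ext; simp [sub_eq_add_neg]
  rw [← e, hp]
  simp only [sub_eq_add_neg]

lemma α₁₂_eq (x y t : ℝ) : d.α₁₂ x y t = d.A x y t 0 := by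
  simp only [α₁₂, A, fL, gL, setIntegral_Iic_comp_add (fun s => d.g₂ s t * d.f₁ s t)]
  simp [mul_comm]

lemma α₃₄_eq (x y t : ℝ) : d.α₃₄ x y t = d.A x y t 1 := by
  simp only [α₃₄, A, fL, gL, setIntegral_Iic_comp_add (fun s => d.g₄ s t * d.f₃ s t)]
  simp [mul_comm]

lemma α₂₁_eq (x y t : ℝ) : d.α₂₁ x y t = d.M x y t 0 0 := by
  simp only [α₂₁, M, fR, gR, setIntegral_Ici_comp_sub (fun s => d.f₂ s t * d.g₁ s t)]
  simp

lemma α₄₁_eq (x y t : ℝ) : d.α₄₁ x y t = d.M x y t 1 0 := by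
  simp only [α₄₁, M, fR, gR, setIntegral_Ici_comp_sub (fun s => d.f₄ s t * d.g₁ s t)]
  simp

lemma α₂₃_eq (x y t : ℝ) : d.α₂₃ x y t = d.M x y t 0 1 := by
  simp only [α₂₃, M, fR, gR, setIntegral_Ici_comp_sub (fun s => d.f₂ s t * d.g₃ s t)]
  simp

lemma α₄₃_eq (x y t : ℝ) : d.α₄₃ x y t = d.M x y t 1 1 := by
  simp only [α₄₃, M, fR, gR, setIntegral_Ici_comp_sub (fun s => d.f₄ s t * d.g₃ s t)]
  simp

lemma Δ_eq (x y t : ℝ) : d.Δ x y t = resDet (d.A x y t) (d.M x y t) := by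
  simp only [Δ, resDet, α₁₂_eq, α₃₄_eq, α₂₁_eq, α₄₁_eq, α₂₃_eq, α₄₃_eq]

lemma Kminus_eq (x y τ t : ℝ) (k : Fin 2) : d.Kminus x y τ t k
    = atSum d.fL x y t k * ∑ j, resR (d.A x y t) (d.M x y t) k j * d.fR j (τ - x) t := by
  fin_cases k <;>
    simp [Kminus, atSum, fL, fR, resR, Fin.sum_univ_two, a₁₁, a₁₂, a₂₁, a₂₂, Δ_eq, α₁₂_eq, α₃₄_eq,
      α₂₁_eq, α₄₁_eq, α₂₃_eq, α₄₃_eq] <;> ring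

lemma Kplus_eq (x y τ t : ℝ) (k : Fin 2) :
    d.Kplus x y τ t k = d.row d.gR x y t k * d.gL k (τ + x) t := by
  fin_cases k <;>
    simp [Kplus, row, resRow, atDiff, gL, gR, resN, Fin.sum_univ_two, b₁₁, b₁₂, b₂₁, b₂₂, Δ_eq,
      α₁₂_eq, α₃₄_eq, α₂₁_eq, α₄₁_eq, α₂₃_eq, α₄₃_eq] <;> ring

lemma q₁₂_eq (k : Fin 2) (x y t : ℝ) :
    d.q₁₂ k x y t = -2 * (atSum d.fL x y t k * d.col d.fR x y t k) := by
  rw [q₁₂, Kminus_eq]; rfl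

lemma q₂₁_eq (k : Fin 2) (x y t : ℝ) :
    d.q₂₁ k x y t = 2 * (d.row d.gR x y t k * atSum d.gL x y t k) := by
  rw [q₂₁, Kplus_eq]; rfl

/-- Regular factors together with their evolution equations, indexed by the half-line; `κ` stands
for `i γ`. -/
structure IsScattering (B : Fin 2 → ℂ) (b κ : ℂ) : Prop where
  fL : ∀ k, IsFactor (Iic 0) (d.fL k)
  gL : ∀ k, IsFactor (Iic 0) (d.gL k)
  fR : ∀ k, IsFactor (Ici 0) (d.fR k)
  gR : ∀ k, IsFactor (Ici 0) (d.gR k)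
  evL : ∀ k y t, dTime (d.fL k) y t
    = 2 * B k * dSpace (d.fL k) y t + κ * dSpace (dSpace (d.fL k)) y t
  evL' : ∀ k y t, dTime (d.gL k) y t
    = 2 * B k * dSpace (d.gL k) y t - κ * dSpace (dSpace (d.gL k)) y t
  evR : ∀ k y t, dTime (d.fR k) y t
    = -(2 * b) * dSpace (d.fR k) y t + -κ * dSpace (dSpace (d.fR k)) y t
  evR' : ∀ k y t, dTime (d.gR k) y t
    = -(2 * b) * dSpace (d.gR k) y t - -κ * dSpace (dSpace (d.gR k)) y t

variable {d}

lemma HalfLineRegular.isScattering (hd : d.HalfLineRegular) {b₁ b₂ b γ : ℝ}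
    (hev : d.Evolves b₁ b₂ b γ) : d.IsScattering ![b₁, b₂] b (Complex.I * γ) where
  fL k := by fin_cases k; exacts [hd.f₁, hd.f₃]
  gL k := by fin_cases k; exacts [hd.g₂, hd.g₄]
  fR k := by fin_cases k; exacts [hd.f₂, hd.f₄]
  gR k := by fin_cases k; exacts [hd.g₁, hd.g₃]
  evL k y t := by
    fin_cases k
    · simpa [DegenerateData.fL] using by linear_combination hev.f₁ y t
    · simpa [DegenerateData.fL] using by linear_combination hev.f₃ y t
  evL' k y t := by
    fin_cases k
    · simpa [DegenerateData.gL] using by linear_combination hev.g₂ y t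
    · simpa [DegenerateData.gL] using by linear_combination hev.g₄ y t
  evR k y t := by
    fin_cases k
    · simpa [DegenerateData.fR] using by linear_combination hev.f₂ y t
    · simpa [DegenerateData.fR] using by linear_combination hev.f₄ y t
  evR' k y t := by
    fin_cases k
    · simpa [DegenerateData.gR] using by linear_combination hev.g₁ y t
    · simpa [DegenerateData.gR] using by linear_combination hev.g₃ y t

/-! The derivatives in `x` and in `y` are computed together, along an arbitrary curve
`τ ↦ (X τ, Z τ)` with velocity `(ex, ez)` in the `(x, y)`-plane at fixed `t`: then `y + x` has
velocity `ez + ex` and `y - x` has velocity `ez - ex`. -/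

section curves

variable {B : Fin 2 → ℂ} {b κ : ℂ} (hs : d.IsScattering B b κ) {X Z : ℝ → ℝ} {ex ez τ : ℝ}
  (hX : HasDerivAt X ex τ) (hZ : HasDerivAt Z ez τ)
include hX hZ

lemma hasDerivAt_atSum {u : Fin 2 → ℝ → ℝ → ℂ}
    (hu : ∀ k y t, HasDerivAt (fun y => u k y t) (dSpaceVec u k y t) y) (t : ℝ) (k : Fin 2) :
    HasDerivAt (fun τ => atSum u (X τ) (Z τ) t k)
      (((ez + ex : ℝ) : ℂ) * atSum (dSpaceVec u) (X τ) (Z τ) t k) τ := by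
  simpa [Function.comp_def, atSum] using (hu k (Z τ + X τ) t).scomp τ (hZ.add hX)

lemma hasDerivAt_atDiff {u : Fin 2 → ℝ → ℝ → ℂ}
    (hu : ∀ k y t, HasDerivAt (fun y => u k y t) (dSpaceVec u k y t) y) (t : ℝ) (k : Fin 2) :
    HasDerivAt (fun τ => atDiff u (X τ) (Z τ) t k)
      (((ez - ex : ℝ) : ℂ) * atDiff (dSpaceVec u) (X τ) (Z τ) t k) τ := by
  simpa [Function.comp_def, atDiff] using (hu k (Z τ - X τ) t).scomp τ (hZ.sub hX)

include hs

lemma IsScattering.hasDerivAt_A (t : ℝ) (k : Fin 2) :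
    HasDerivAt (fun τ => d.A (X τ) (Z τ) t k) (((ez + ex : ℝ) : ℂ) * d.dA (X τ) (Z τ) t k) τ := by
  have hc : Continuous fun s => d.fL k s t * d.gL k s t :=
    ((hs.fL k).contDiff_space t).continuous.mul ((hs.gL k).contDiff_space t).continuous
  simpa [Function.comp_def, A, dA, atSum] using
    (hasDerivAt_integral_Iic hc ((hs.fL k).integrableOn_mul (hs.gL k) t) (Z τ + X τ)).scomp τ
      (hZ.add hX)

lemma IsScattering.hasDerivAt_M (t : ℝ) (i j : Fin 2) :
    HasDerivAt (fun τ => d.M (X τ) (Z τ) t i j)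
      (-((ez - ex : ℝ) : ℂ) * (atDiff d.fR (X τ) (Z τ) t i * atDiff d.gR (X τ) (Z τ) t j)) τ := by
  have hc : Continuous fun s => d.fR i s t * d.gR j s t :=
    ((hs.fR i).contDiff_space t).continuous.mul ((hs.gR j).contDiff_space t).continuous
  have := (hasDerivAt_integral_Ici hc ((hs.fR i).integrableOn_mul (hs.gR j) t) (Z τ - X τ)).scomp τ
      (hZ.sub hX)
  simp only [Function.comp_def, Complex.real_smul] at this
  refine this.congr_deriv ?_
  simp only [atDiff]; ring

variable {t : ℝ} (h : d.Δ (X τ) (Z τ) t ≠ 0)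
include h

lemma IsScattering.hasDerivAt_Y (i j : Fin 2) :
    HasDerivAt (fun τ => d.Y (X τ) (Z τ) t i j)
      (((ez + ex : ℝ) : ℂ) * ∑ l, d.Y (X τ) (Z τ) t i l * d.dA (X τ) (Z τ) t l
          * d.Y (X τ) (Z τ) t l j
        - ((ez - ex : ℝ) : ℂ) * (d.col d.fR (X τ) (Z τ) t i * d.row d.gR (X τ) (Z τ) t j)) τ :=
  hasDerivAt_resY_rankOne (hs.hasDerivAt_A hX hZ t) (hs.hasDerivAt_M hX hZ t) (d.Δ_eq .. ▸ h) i j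

lemma IsScattering.hasDerivAt_col {u : Fin 2 → ℝ → ℝ → ℂ}
    (hu : ∀ k y t, HasDerivAt (fun y => u k y t) (dSpaceVec u k y t) y) (k : Fin 2) :
    HasDerivAt (fun τ => d.col u (X τ) (Z τ) t k)
      (((ez + ex : ℝ) : ℂ) * ∑ l, d.Y (X τ) (Z τ) t k l * d.dA (X τ) (Z τ) t l
          * d.col u (X τ) (Z τ) t l
        + ((ez - ex : ℝ) : ℂ) * (d.col (dSpaceVec u) (X τ) (Z τ) t k
          - d.col d.fR (X τ) (Z τ) t k * d.form d.gR u (X τ) (Z τ) t)) τ :=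
  hasDerivAt_resCol_rankOne (hs.hasDerivAt_A hX hZ t) (hs.hasDerivAt_M hX hZ t) (d.Δ_eq .. ▸ h)
    (hasDerivAt_atDiff hX hZ hu t) k

lemma IsScattering.hasDerivAt_row {v : Fin 2 → ℝ → ℝ → ℂ}
    (hv : ∀ k y t, HasDerivAt (fun y => v k y t) (dSpaceVec v k y t) y) (k : Fin 2) :
    HasDerivAt (fun τ => d.row v (X τ) (Z τ) t k)
      (((ez + ex : ℝ) : ℂ) * ∑ l, d.row v (X τ) (Z τ) t l * d.dA (X τ) (Z τ) t l
          * d.Y (X τ) (Z τ) t l k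
        + ((ez - ex : ℝ) : ℂ) * (d.row (dSpaceVec v) (X τ) (Z τ) t k
          - d.form v d.fR (X τ) (Z τ) t * d.row d.gR (X τ) (Z τ) t k)) τ :=
  hasDerivAt_resRow_rankOne (hs.hasDerivAt_A hX hZ t) (hs.hasDerivAt_M hX hZ t) (d.Δ_eq .. ▸ h)
    (hasDerivAt_atDiff hX hZ hv t) k

lemma IsScattering.hasDerivAt_form {v u : Fin 2 → ℝ → ℝ → ℂ}
    (hv : ∀ k y t, HasDerivAt (fun y => v k y t) (dSpaceVec v k y t) y)
    (hu : ∀ k y t, HasDerivAt (fun y => u k y t) (dSpaceVec u k y t) y) :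
    HasDerivAt (fun τ => d.form v u (X τ) (Z τ) t)
      (((ez + ex : ℝ) : ℂ) * ∑ l, d.row v (X τ) (Z τ) t l * d.dA (X τ) (Z τ) t l
          * d.col u (X τ) (Z τ) t l
        + ((ez - ex : ℝ) : ℂ) * (d.form (dSpaceVec v) u (X τ) (Z τ) t
          + d.form v (dSpaceVec u) (X τ) (Z τ) t
          - d.form v d.fR (X τ) (Z τ) t * d.form d.gR u (X τ) (Z τ) t)) τ :=
  hasDerivAt_resForm_rankOne (hs.hasDerivAt_A hX hZ t) (hs.hasDerivAt_M hX hZ t) (d.Δ_eq .. ▸ h)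
    (hasDerivAt_atDiff hX hZ hv t) (hasDerivAt_atDiff hX hZ hu t)

end curves

section time

variable {B : Fin 2 → ℂ} {b κ : ℂ} (hs : d.IsScattering B b κ)
include hs

/-- The time derivative of `A`. -/
lemma IsScattering.hasDerivAt_time_A (x y t : ℝ) (k : Fin 2) :
    HasDerivAt (fun t => d.A x y t k) (flux (2 * B k) κ (d.fL k) (d.gL k) (y + x) t) t :=
  hasDerivAt_time_integral_Iic (hs.fL k) (hs.gL k) (hs.evL k) (hs.evL' k) _ t

/-- The time derivative of `M`. -/
lemma IsScattering.hasDerivAt_time_M (x y t : ℝ) (i j : Fin 2) :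
    HasDerivAt (fun t => d.M x y t i j)
      (-flux (-(2 * b)) (-κ) (d.fR i) (d.gR j) (y - x) t) t :=
  hasDerivAt_time_integral_Ici (hs.fR i) (hs.gR j) (hs.evR i) (hs.evR' j) _ t

lemma IsScattering.hasDerivAt_time_col {x y t : ℝ} (h : d.Δ x y t ≠ 0) (k : Fin 2) :
    HasDerivAt (fun t => d.col d.fR x y t k)
      (∑ l, d.Y x y t k l * flux (2 * B l) κ (d.fL l) (d.gL l) (y + x) t * d.col d.fR x y t l
        + 2 * b * (d.col d.fR x y t k * d.form d.gR d.fR x y t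
          - d.col (dSpaceVec d.fR) x y t k)
        + -κ * (d.col d.fR x y t k * d.form (dSpaceVec d.gR) d.fR x y t
          - d.col (dSpaceVec d.fR) x y t k * d.form d.gR d.fR x y t
          + d.col (dSpaceVec (dSpaceVec d.fR)) x y t k)) t :=
  hasDerivAt_resCol_flux (a' := fun l => flux (2 * B l) κ (d.fL l) (d.gL l) (y + x) t)
    (u := fun t => atDiff d.fR x y t) (v := fun t => atDiff d.gR x y t)
    (γ₁ := atDiff (dSpaceVec d.gR) x y t) (φ₁ := atDiff (dSpaceVec d.fR) x y t)
    (φ₂ := atDiff (dSpaceVec (dSpaceVec d.fR)) x y t)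
    (hs.hasDerivAt_time_A x y t)
    (fun i j => (hs.hasDerivAt_time_M x y t i j).congr_deriv (by
      simp only [flux, atDiff, dSpaceVec]; ring))
    (d.Δ_eq .. ▸ h)
    (fun i => ((hs.fR i).hasDerivAt_time (y - x) t).congr_deriv (hs.evR i _ t)) k

lemma IsScattering.hasDerivAt_time_row {x y t : ℝ} (h : d.Δ x y t ≠ 0) (k : Fin 2) :
    HasDerivAt (fun t => d.row d.gR x y t k)
      (∑ l, d.row d.gR x y t l * flux (2 * B l) κ (d.fL l) (d.gL l) (y + x) t * d.Y x y t l k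
        + 2 * b * (d.form d.gR d.fR x y t * d.row d.gR x y t k
          - d.row (dSpaceVec d.gR) x y t k)
        + -κ * (d.form d.gR d.fR x y t * d.row (dSpaceVec d.gR) x y t k
          - d.form d.gR (dSpaceVec d.fR) x y t * d.row d.gR x y t k
          - d.row (dSpaceVec (dSpaceVec d.gR)) x y t k)) t :=
  hasDerivAt_resRow_flux (a' := fun l => flux (2 * B l) κ (d.fL l) (d.gL l) (y + x) t)
    (u := fun t => atDiff d.fR x y t) (v := fun t => atDiff d.gR x y t)
    (γ₁ := atDiff (dSpaceVec d.gR) x y t) (φ₁ := atDiff (dSpaceVec d.fR) x y t)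
    (γ₂ := atDiff (dSpaceVec (dSpaceVec d.gR)) x y t)
    (hs.hasDerivAt_time_A x y t)
    (fun i j => (hs.hasDerivAt_time_M x y t i j).congr_deriv (by
      simp only [flux, atDiff, dSpaceVec]; ring))
    (d.Δ_eq .. ▸ h)
    (fun i => ((hs.gR i).hasDerivAt_time (y - x) t).congr_deriv (hs.evR' i _ t)) k

end time

end DegenerateData
end

noncomputable section

namespace DegenerateData

variable (d : DegenerateData)

/-! ### The quasi-potentials and the equations -/

/-- The derivative of `q₁₂` with respect to `y + x`. -/
def q₁₂Sum (k : Fin 2) (x y t : ℝ) : ℂ :=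
  -2 * (atSum (dSpaceVec d.fL) x y t k * d.col d.fR x y t k
    + atSum d.fL x y t k * ∑ l, d.Y x y t k l * d.dA x y t l * d.col d.fR x y t l)

/-- The derivative of `q₁₂` with respect to `y - x`. -/
def q₁₂Diff (k : Fin 2) (x y t : ℝ) : ℂ :=
  -2 * (atSum d.fL x y t k * (d.col (dSpaceVec d.fR) x y t k
    - d.col d.fR x y t k * d.form d.gR d.fR x y t))

/-- The derivative of `q₂₁` with respect to `y + x`. -/
def q₂₁Sum (k : Fin 2) (x y t : ℝ) : ℂ :=
  2 * (d.row d.gR x y t k * atSum (dSpaceVec d.gL) x y t k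
    + (∑ l, d.row d.gR x y t l * d.dA x y t l * d.Y x y t l k) * atSum d.gL x y t k)

/-- The derivative of `q₂₁` with respect to `y - x`. -/
def q₂₁Diff (k : Fin 2) (x y t : ℝ) : ℂ :=
  2 * ((d.row (dSpaceVec d.gR) x y t k
    - d.form d.gR d.fR x y t * d.row d.gR x y t k) * atSum d.gL x y t k)

/-- The quasi-potential `p`, the function `-2 κ (∂_r - ∂_s) Z` with `r = y + x`, `s = y - x` and
`Z = d.form d.gR d.fR`; `κ` stands for `i γ`. -/
def potential (κ : ℂ) (x y t : ℝ) : ℂ :=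
  -2 * κ * (∑ l, d.row d.gR x y t l * d.dA x y t l * d.col d.fR x y t l
    - d.form (dSpaceVec d.gR) d.fR x y t - d.form d.gR (dSpaceVec d.fR) x y t
    + d.form d.gR d.fR x y t ^ 2)

/-- The quasi-potential `p_{km}`, the function `2 (B_m - B_k) W - 2 κ (∂_r - ∂_s) W` with
`r = y + x`, `s = y - x` and `W = d.fL k * d.Y k m * d.gL m`; `κ` stands for `i γ`. -/
def matrixPotential (B : Fin 2 → ℂ) (κ : ℂ) (k m : Fin 2) (x y t : ℝ) : ℂ :=
  2 * (B m - B k) * (atSum d.fL x y t k * d.Y x y t k m * atSum d.gL x y t m)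
    - 2 * κ * (atSum (dSpaceVec d.fL) x y t k * d.Y x y t k m * atSum d.gL x y t m
      + atSum d.fL x y t k * d.Y x y t k m * atSum (dSpaceVec d.gL) x y t m
      + atSum d.fL x y t k * (∑ l, d.Y x y t k l * d.dA x y t l * d.Y x y t l m)
        * atSum d.gL x y t m
      + atSum d.fL x y t k * (d.col d.fR x y t k * d.row d.gR x y t m) * atSum d.gL x y t m)

variable {d} {B : Fin 2 → ℂ} {b κ : ℂ} (hs : d.IsScattering B b κ)
include hs

lemma IsScattering.deriv_fL (k : Fin 2) (y t : ℝ) :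
    HasDerivAt (fun y => d.fL k y t) (dSpaceVec d.fL k y t) y := (hs.fL k).hasDerivAt_space y t

lemma IsScattering.deriv_gL (k : Fin 2) (y t : ℝ) :
    HasDerivAt (fun y => d.gL k y t) (dSpaceVec d.gL k y t) y := (hs.gL k).hasDerivAt_space y t

lemma IsScattering.deriv_fR (k : Fin 2) (y t : ℝ) :
    HasDerivAt (fun y => d.fR k y t) (dSpaceVec d.fR k y t) y := (hs.fR k).hasDerivAt_space y t

lemma IsScattering.deriv_gR (k : Fin 2) (y t : ℝ) :
    HasDerivAt (fun y => d.gR k y t) (dSpaceVec d.gR k y t) y := (hs.gR k).hasDerivAt_space y t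

lemma IsScattering.deriv_fL' (k : Fin 2) (y t : ℝ) : HasDerivAt (fun y => dSpaceVec d.fL k y t)
    (dSpaceVec (dSpaceVec d.fL) k y t) y := (hs.fL k).hasDerivAt_dSpace y t

lemma IsScattering.deriv_gL' (k : Fin 2) (y t : ℝ) : HasDerivAt (fun y => dSpaceVec d.gL k y t)
    (dSpaceVec (dSpaceVec d.gL) k y t) y := (hs.gL k).hasDerivAt_dSpace y t

lemma IsScattering.deriv_fR' (k : Fin 2) (y t : ℝ) : HasDerivAt (fun y => dSpaceVec d.fR k y t)
    (dSpaceVec (dSpaceVec d.fR) k y t) y := (hs.fR k).hasDerivAt_dSpace y t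

lemma IsScattering.deriv_gR' (k : Fin 2) (y t : ℝ) : HasDerivAt (fun y => dSpaceVec d.gR k y t)
    (dSpaceVec (dSpaceVec d.gR) k y t) y := (hs.gR k).hasDerivAt_dSpace y t

section curves

variable {X Z : ℝ → ℝ} {ex ez τ : ℝ} (hX : HasDerivAt X ex τ) (hZ : HasDerivAt Z ez τ) {t : ℝ}
include hX hZ

lemma IsScattering.eventually_ne (h : d.Δ (X τ) (Z τ) t ≠ 0) :
    ∀ᶠ s in 𝓝 τ, d.Δ (X s) (Z s) t ≠ 0 := by
  simp only [Δ_eq] at h ⊢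
  exact (hasDerivAt_resDet (hs.hasDerivAt_A hX hZ t)
    (hs.hasDerivAt_M hX hZ t)).continuousAt.eventually_ne h

lemma IsScattering.hasDerivAt_dA (t : ℝ) (k : Fin 2) :
    HasDerivAt (fun τ => d.dA (X τ) (Z τ) t k)
      (((ez + ex : ℝ) : ℂ) * (atSum (dSpaceVec d.fL) (X τ) (Z τ) t k * atSum d.gL (X τ) (Z τ) t k
        + atSum d.fL (X τ) (Z τ) t k * atSum (dSpaceVec d.gL) (X τ) (Z τ) t k)) τ :=
  ((hasDerivAt_atSum hX hZ hs.deriv_fL t k).mul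
    (hasDerivAt_atSum hX hZ hs.deriv_gL t k)).congr_deriv (by ring)

variable (h : d.Δ (X τ) (Z τ) t ≠ 0)
include h

lemma IsScattering.hasDerivAt_q₁₂ (k : Fin 2) :
    HasDerivAt (fun τ => d.q₁₂ k (X τ) (Z τ) t)
      (((ez + ex : ℝ) : ℂ) * d.q₁₂Sum k (X τ) (Z τ) t
        + ((ez - ex : ℝ) : ℂ) * d.q₁₂Diff k (X τ) (Z τ) t) τ := by
  simp only [q₁₂_eq]
  refine (((hasDerivAt_atSum hX hZ hs.deriv_fL t k).mul
    (hs.hasDerivAt_col hX hZ h hs.deriv_fR k)).const_mul (-2)).congr_deriv ?_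
  simp only [q₁₂Sum, q₁₂Diff]
  ring

lemma IsScattering.hasDerivAt_q₂₁ (k : Fin 2) :
    HasDerivAt (fun τ => d.q₂₁ k (X τ) (Z τ) t)
      (((ez + ex : ℝ) : ℂ) * d.q₂₁Sum k (X τ) (Z τ) t
        + ((ez - ex : ℝ) : ℂ) * d.q₂₁Diff k (X τ) (Z τ) t) τ := by
  simp only [q₂₁_eq]
  refine (((hs.hasDerivAt_row hX hZ h hs.deriv_gR k).mul
    (hasDerivAt_atSum hX hZ hs.deriv_gL t k)).const_mul 2).congr_deriv ?_
  simp only [q₂₁Sum, q₂₁Diff]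
  ring

end curves

section point

variable {x y t : ℝ} (h : d.Δ x y t ≠ 0)
include h

lemma IsScattering.dx_q₁₂ (k : Fin 2) :
    dx (d.q₁₂ k) x y t = d.q₁₂Sum k x y t - d.q₁₂Diff k x y t := by
  have := (hs.hasDerivAt_q₁₂ (hasDerivAt_id' x) (hasDerivAt_const x y) h k).deriv
  rw [dx, this]; push_cast; ring

lemma IsScattering.dy_q₁₂ (k : Fin 2) :
    dy (d.q₁₂ k) x y t = d.q₁₂Sum k x y t + d.q₁₂Diff k x y t := by
  have := (hs.hasDerivAt_q₁₂ (hasDerivAt_const y x) (hasDerivAt_id' y) h k).deriv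
  rw [dy, this]; push_cast; ring

lemma IsScattering.dx_q₂₁ (k : Fin 2) :
    dx (d.q₂₁ k) x y t = d.q₂₁Sum k x y t - d.q₂₁Diff k x y t := by
  have := (hs.hasDerivAt_q₂₁ (hasDerivAt_id' x) (hasDerivAt_const x y) h k).deriv
  rw [dx, this]; push_cast; ring

lemma IsScattering.dy_q₂₁ (k : Fin 2) :
    dy (d.q₂₁ k) x y t = d.q₂₁Sum k x y t + d.q₂₁Diff k x y t := by
  have := (hs.hasDerivAt_q₂₁ (hasDerivAt_const y x) (hasDerivAt_id' y) h k).deriv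
  rw [dy, this]; push_cast; ring

lemma IsScattering.dt_q₁₂ (k : Fin 2) :
    dt (d.q₁₂ k) x y t = -2 * (dTime (d.fL k) (y + x) t * d.col d.fR x y t k
      + atSum d.fL x y t k * (∑ l, d.Y x y t k l * flux (2 * B l) κ (d.fL l) (d.gL l) (y + x) t
          * d.col d.fR x y t l
        + 2 * b * (d.col d.fR x y t k * d.form d.gR d.fR x y t
          - d.col (dSpaceVec d.fR) x y t k)
        + -κ * (d.col d.fR x y t k * d.form (dSpaceVec d.gR) d.fR x y t
          - d.col (dSpaceVec d.fR) x y t k * d.form d.gR d.fR x y t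
          + d.col (dSpaceVec (dSpaceVec d.fR)) x y t k))) := by
  simp only [dt, q₁₂_eq]
  exact ((((hs.fL k).hasDerivAt_time (y + x) t).mul (hs.hasDerivAt_time_col h k)).const_mul
    (-2)).deriv

lemma IsScattering.dt_q₂₁ (k : Fin 2) :
    dt (d.q₂₁ k) x y t = 2 * ((∑ l, d.row d.gR x y t l
          * flux (2 * B l) κ (d.fL l) (d.gL l) (y + x) t * d.Y x y t l k
        + 2 * b * (d.form d.gR d.fR x y t * d.row d.gR x y t k
          - d.row (dSpaceVec d.gR) x y t k)
        + -κ * (d.form d.gR d.fR x y t * d.row (dSpaceVec d.gR) x y t k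
          - d.form d.gR (dSpaceVec d.fR) x y t * d.row d.gR x y t k
          - d.row (dSpaceVec (dSpaceVec d.gR)) x y t k)) * atSum d.gL x y t k
      + d.row d.gR x y t k * dTime (d.gL k) (y + x) t) := by
  simp only [dt, q₂₁_eq]
  exact (((hs.hasDerivAt_time_row h k).mul ((hs.gL k).hasDerivAt_time (y + x) t)).const_mul
    2).deriv

/-- The evolution equation of `(q₁, q₂)`, with `α_k = -(B_k + b)` and `β_k = B_k - b`. -/
lemma IsScattering.eq_q₁₂ (k : Fin 2) :
    dt (d.q₁₂ k) x y t - (B k + b) * dx (d.q₁₂ k) x y t - (B k - b) * dy (d.q₁₂ k) x y t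
        - κ * dx (dy (d.q₁₂ k)) x y t
      = ∑ m, d.matrixPotential B κ k m x y t * d.q₁₂ m x y t
        - d.potential κ x y t * d.q₁₂ k x y t := by
  have hX := hasDerivAt_id' x
  have hZ := hasDerivAt_const x y
  -- `∂q/∂y` is known at all points near `(x, y)` on the line through it in the `x`-direction
  have e : (fun z => dy (d.q₁₂ k) z y t)
      =ᶠ[𝓝 x] fun z => d.q₁₂Sum k z y t + d.q₁₂Diff k z y t :=
    (hs.eventually_ne hX hZ h).mono fun z hz => hs.dy_q₁₂ hz k
  have hf := hasDerivAt_atSum hX hZ hs.deriv_fL t k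
  have hf' := hasDerivAt_atSum hX hZ hs.deriv_fL' t k
  have hc := hs.hasDerivAt_col hX hZ h hs.deriv_fR
  have hc' := hs.hasDerivAt_col hX hZ h hs.deriv_fR' k
  have hφ := hs.hasDerivAt_form hX hZ h hs.deriv_gR hs.deriv_fR
  have h2 : dx (dy (d.q₁₂ k)) x y t = _ := e.deriv_eq.trans
    ((((hf'.mul (hc k)).add (hf.mul (HasDerivAt.fun_sum fun l (_ : l ∈ Finset.univ) =>
      ((hs.hasDerivAt_Y hX hZ h k l).mul (hs.hasDerivAt_dA hX hZ t l)).mul (hc l)))).const_mul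
        (-2)).add ((hf.mul (hc'.sub ((hc k).mul hφ))).const_mul (-2))).deriv
  rw [h2, hs.dx_q₁₂ h, hs.dy_q₁₂ h, hs.dt_q₁₂ h, hs.evL]
  simp only [q₁₂_eq, matrixPotential, potential, q₁₂Sum, q₁₂Diff, flux, Fin.sum_univ_two, dA,
    Pi.mul_apply, Pi.sub_apply]
  have a₁ : ∀ l, d.fL l (y + x) t = atSum d.fL x y t l := fun _ => rfl
  have a₂ : ∀ l, d.gL l (y + x) t = atSum d.gL x y t l := fun _ => rfl
  have a₃ : ∀ l, dSpace (d.fL l) (y + x) t = atSum (dSpaceVec d.fL) x y t l := fun _ => rfl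
  have a₄ : ∀ l, dSpace (d.gL l) (y + x) t = atSum (dSpaceVec d.gL) x y t l := fun _ => rfl
  have a₅ : ∀ l, dSpace (dSpace (d.fL l)) (y + x) t
    = atSum (dSpaceVec (dSpaceVec d.fL)) x y t l := fun _ => rfl
  simp only [a₁, a₂, a₃, a₄, a₅]
  -- with all derivatives inserted, both sides are polynomials in the entries of `Y` and in the
  -- columns, rows and scalars, and they agree identically
  push_cast
  ring

/-- The evolution equation of `(q₃, q₄)`, with `α_k = -(B_k + b)` and `β_k = B_k - b`. -/
lemma IsScattering.eq_q₂₁ (k : Fin 2) :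
    dt (d.q₂₁ k) x y t - (B k + b) * dx (d.q₂₁ k) x y t - (B k - b) * dy (d.q₂₁ k) x y t
        + κ * dx (dy (d.q₂₁ k)) x y t
      = d.potential κ x y t * d.q₂₁ k x y t
        - ∑ m, d.matrixPotential B κ m k x y t * d.q₂₁ m x y t := by
  have hX := hasDerivAt_id' x
  have hZ := hasDerivAt_const x y
  -- `∂q/∂y` is known at all points near `(x, y)` on the line through it in the `x`-direction
  have e : (fun z => dy (d.q₂₁ k) z y t)
      =ᶠ[𝓝 x] fun z => d.q₂₁Sum k z y t + d.q₂₁Diff k z y t :=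
    (hs.eventually_ne hX hZ h).mono fun z hz => hs.dy_q₂₁ hz k
  have hf := hasDerivAt_atSum hX hZ hs.deriv_gL t k
  have hf' := hasDerivAt_atSum hX hZ hs.deriv_gL' t k
  have hc := hs.hasDerivAt_row hX hZ h hs.deriv_gR
  have hc' := hs.hasDerivAt_row hX hZ h hs.deriv_gR' k
  have hφ := hs.hasDerivAt_form hX hZ h hs.deriv_gR hs.deriv_fR
  have h2 : dx (dy (d.q₂₁ k)) x y t = _ := e.deriv_eq.trans
    (((((hc k).mul hf').add ((HasDerivAt.fun_sum fun l (_ : l ∈ Finset.univ) =>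
      ((hc l).mul (hs.hasDerivAt_dA hX hZ t l)).mul (hs.hasDerivAt_Y hX hZ h l k)).mul
        hf)).const_mul 2).add (((hc'.sub (hφ.mul (hc k))).mul hf).const_mul 2)).deriv
  rw [h2, hs.dx_q₂₁ h, hs.dy_q₂₁ h, hs.dt_q₂₁ h, hs.evL']
  simp only [q₂₁_eq, matrixPotential, potential, q₂₁Sum, q₂₁Diff, flux, Fin.sum_univ_two, dA,
    Pi.mul_apply, Pi.sub_apply]
  have a₁ : ∀ l, d.fL l (y + x) t = atSum d.fL x y t l := fun _ => rfl
  have a₂ : ∀ l, d.gL l (y + x) t = atSum d.gL x y t l := fun _ => rfl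
  have a₃ : ∀ l, dSpace (d.fL l) (y + x) t = atSum (dSpaceVec d.fL) x y t l := fun _ => rfl
  have a₄ : ∀ l, dSpace (d.gL l) (y + x) t = atSum (dSpaceVec d.gL) x y t l := fun _ => rfl
  have a₅ : ∀ l, dSpace (dSpace (d.gL l)) (y + x) t
    = atSum (dSpaceVec (dSpaceVec d.gL)) x y t l := fun _ => rfl
  simp only [a₁, a₂, a₃, a₄, a₅]
  -- with all derivatives inserted, both sides are polynomials in the entries of `Y` and in the
  -- columns, rows and scalars, and they agree identically
  push_cast
  ring

/-- The product `q_k q_{2+m}`, differentiated in `x`. -/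
lemma IsScattering.hasDerivAt_mul_q (k m : Fin 2) :
    HasDerivAt (fun z => d.q₁₂ k z y t * d.q₂₁ m z y t)
      ((d.q₁₂Sum k x y t - d.q₁₂Diff k x y t) * d.q₂₁ m x y t
        + d.q₁₂ k x y t * (d.q₂₁Sum m x y t - d.q₂₁Diff m x y t)) x := by
  have h₁ := hs.hasDerivAt_q₁₂ (hasDerivAt_id' x) (hasDerivAt_const x y) h k
  have h₂ := hs.hasDerivAt_q₂₁ (hasDerivAt_id' x) (hasDerivAt_const x y) h m
  refine (h₁.mul h₂).congr_deriv ?_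
  push_cast; ring

/-- The equation of the quasi-potential `p`, which rests on `∑ q_m q_{2+m} = -4 ∂Z/∂r`. -/
lemma IsScattering.eq_potential :
    dXi (d.potential κ) x y t
      = κ * dx (fun x y t => ∑ m, d.q₁₂ m x y t * d.q₂₁ m x y t) x y t := by
  have key := fun (X Z : ℝ → ℝ) (ex ez τ : ℝ) (hX : HasDerivAt X ex τ) (hZ : HasDerivAt Z ez τ)
      (h : d.Δ (X τ) (Z τ) t ≠ 0) =>
    ((((HasDerivAt.fun_sum fun l (_ : l ∈ Finset.univ) =>
      ((hs.hasDerivAt_row hX hZ h hs.deriv_gR l).mul (hs.hasDerivAt_dA hX hZ t l)).mul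
        (hs.hasDerivAt_col hX hZ h hs.deriv_fR l)).sub
      (hs.hasDerivAt_form hX hZ h hs.deriv_gR' hs.deriv_fR)).sub
      (hs.hasDerivAt_form hX hZ h hs.deriv_gR hs.deriv_fR')).add
      ((hs.hasDerivAt_form hX hZ h hs.deriv_gR hs.deriv_fR).fun_pow 2)).const_mul (-2 * κ)
  have e₁ : dx (d.potential κ) x y t = _ :=
    (key _ _ _ _ x (hasDerivAt_id' x) (hasDerivAt_const x y) h).deriv
  have e₂ : dy (d.potential κ) x y t = _ :=
    (key _ _ _ _ y (hasDerivAt_const y x) (hasDerivAt_id' y) h).deriv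
  have e₃ : dx (fun x y t => ∑ m, d.q₁₂ m x y t * d.q₂₁ m x y t) x y t = _ :=
    (HasDerivAt.fun_sum fun m (_ : m ∈ Finset.univ) => hs.hasDerivAt_mul_q h m m).deriv
  rw [dXi, e₁, e₂, e₃]
  simp only [q₁₂_eq, q₂₁_eq, q₁₂Sum, q₁₂Diff, q₂₁Sum, q₂₁Diff, Fin.sum_univ_two, dA, Pi.mul_apply]
  push_cast
  ring

/-- The equation of the quasi-potential `p_{km}`, which rests on `q_k q_{2+m} = 4 ∂W/∂s`. -/
lemma IsScattering.eq_matrixPotential (k m : Fin 2) :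
    dEta (d.matrixPotential B κ k m) x y t
      = (B m - B k) * (d.q₁₂ k x y t * d.q₂₁ m x y t)
        - κ * dx (fun x y t => d.q₁₂ k x y t * d.q₂₁ m x y t) x y t := by
  have key := fun (X Z : ℝ → ℝ) (ex ez τ : ℝ) (hX : HasDerivAt X ex τ) (hZ : HasDerivAt Z ez τ)
      (h : d.Δ (X τ) (Z τ) t ≠ 0) =>
    have hY := hs.hasDerivAt_Y hX hZ h
    have f₀ := hasDerivAt_atSum hX hZ hs.deriv_fL t k
    have f₁ := hasDerivAt_atSum hX hZ hs.deriv_fL' t k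
    have g₀ := hasDerivAt_atSum hX hZ hs.deriv_gL t m
    have g₁ := hasDerivAt_atSum hX hZ hs.deriv_gL' t m
    (((f₀.mul (hY k m)).mul g₀).const_mul (2 * (B m - B k))).sub
      ((((((f₁.mul (hY k m)).mul g₀).add ((f₀.mul (hY k m)).mul g₁)).add
        ((f₀.mul (HasDerivAt.fun_sum fun l (_ : l ∈ Finset.univ) =>
          ((hY k l).mul (hs.hasDerivAt_dA hX hZ t l)).mul (hY l m))).mul g₀)).add
        ((f₀.mul ((hs.hasDerivAt_col hX hZ h hs.deriv_fR k).mul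
          (hs.hasDerivAt_row hX hZ h hs.deriv_gR m))).mul g₀)).const_mul (2 * κ))
  have e₁ : dx (d.matrixPotential B κ k m) x y t = _ :=
    (key _ _ _ _ x (hasDerivAt_id' x) (hasDerivAt_const x y) h).deriv
  have e₂ : dy (d.matrixPotential B κ k m) x y t = _ :=
    (key _ _ _ _ y (hasDerivAt_const y x) (hasDerivAt_id' y) h).deriv
  have e₃ : dx (fun x y t => d.q₁₂ k x y t * d.q₂₁ m x y t) x y t = _ :=
    (hs.hasDerivAt_mul_q h k m).deriv
  rw [dEta, e₁, e₂, e₃]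
  simp only [q₁₂_eq, q₂₁_eq, q₁₂Sum, q₁₂Diff, q₂₁Sum, q₂₁Diff, Fin.sum_univ_two, dA, Pi.mul_apply]
  push_cast
  ring

end point

end DegenerateData
end

noncomputable section

namespace DegenerateData

/-! ### Regularity -/

variable {d : DegenerateData} {B : Fin 2 → ℂ} {b κ : ℂ}

lemma contDiff_atSum {u : Fin 2 → ℝ → ℝ → ℂ} {k : Fin 2}
    (hu : ContDiff ℝ 1 fun z : ℝ × ℝ => u k z.1 z.2) :
    ContDiff ℝ 1 fun z : ℝ × ℝ × ℝ => atSum u z.1 z.2.1 z.2.2 k :=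
  hu.comp (by fun_prop : ContDiff ℝ 1 fun z : ℝ × ℝ × ℝ => (z.2.1 + z.1, z.2.2))

lemma contDiff_atDiff {u : Fin 2 → ℝ → ℝ → ℂ} {k : Fin 2}
    (hu : ContDiff ℝ 1 fun z : ℝ × ℝ => u k z.1 z.2) :
    ContDiff ℝ 1 fun z : ℝ × ℝ × ℝ => atDiff u z.1 z.2.1 z.2.2 k :=
  hu.comp (by fun_prop : ContDiff ℝ 1 fun z : ℝ × ℝ × ℝ => (z.2.1 - z.1, z.2.2))

lemma continuous_atSum {u : Fin 2 → ℝ → ℝ → ℂ} {k : Fin 2}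
    (hu : Continuous fun z : ℝ × ℝ => u k z.1 z.2) :
    Continuous fun z : ℝ × ℝ × ℝ => atSum u z.1 z.2.1 z.2.2 k :=
  hu.comp (by fun_prop : Continuous fun z : ℝ × ℝ × ℝ => (z.2.1 + z.1, z.2.2))

lemma continuous_atDiff {u : Fin 2 → ℝ → ℝ → ℂ} {k : Fin 2}
    (hu : Continuous fun z : ℝ × ℝ => u k z.1 z.2) :
    Continuous fun z : ℝ × ℝ × ℝ => atDiff u z.1 z.2.1 z.2.2 k :=
  hu.comp (by fun_prop : Continuous fun z : ℝ × ℝ × ℝ => (z.2.1 - z.1, z.2.2))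

lemma contDiff_space_atSum {n : WithTop ℕ∞} {u : Fin 2 → ℝ → ℝ → ℂ} {k : Fin 2} {t : ℝ}
    (hu : ContDiff ℝ n fun y => u k y t) :
    ContDiff ℝ n fun w : ℝ × ℝ => atSum u w.1 w.2 t k :=
  hu.comp (by fun_prop : ContDiff ℝ n fun w : ℝ × ℝ => w.2 + w.1)

lemma contDiff_space_atDiff {n : WithTop ℕ∞} {u : Fin 2 → ℝ → ℝ → ℂ} {k : Fin 2} {t : ℝ}
    (hu : ContDiff ℝ n fun y => u k y t) :
    ContDiff ℝ n fun w : ℝ × ℝ => atDiff u w.1 w.2 t k :=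
  hu.comp (by fun_prop : ContDiff ℝ n fun w : ℝ × ℝ => w.2 - w.1)

section
variable (hs : d.IsScattering B b κ)
include hs

lemma IsScattering.contDiff_A (k : Fin 2) :
    ContDiff ℝ 1 fun z : ℝ × ℝ × ℝ => d.A z.1 z.2.1 z.2.2 k := by
  have hc : ContDiff ℝ 1 fun z : ℝ × ℝ => ∫ s in Iic z.1, d.fL k s z.2 * d.gL k s z.2 :=
    contDiff_one_of_hasDerivAt_partial (u := fun r t => ∫ s in Iic r, d.fL k s t * d.gL k s t)
      (fun r t => hasDerivAt_integral_Iic (((hs.fL k).contDiff_space t).continuous.mul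
        ((hs.gL k).contDiff_space t).continuous) ((hs.fL k).integrableOn_mul (hs.gL k) t) r)
      (fun r t => hasDerivAt_time_integral_Iic (hs.fL k) (hs.gL k) (hs.evL k) (hs.evL' k) r t)
      ((hs.fL k).continuous.mul (hs.gL k).continuous) (continuous_flux (hs.fL k) (hs.gL k))
  exact hc.comp (by fun_prop : ContDiff ℝ 1 fun z : ℝ × ℝ × ℝ => (z.2.1 + z.1, z.2.2))

lemma IsScattering.contDiff_M (i j : Fin 2) :
    ContDiff ℝ 1 fun z : ℝ × ℝ × ℝ => d.M z.1 z.2.1 z.2.2 i j := by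
  have hc : ContDiff ℝ 1 fun z : ℝ × ℝ => ∫ s in Ici z.1, d.fR i s z.2 * d.gR j s z.2 :=
    contDiff_one_of_hasDerivAt_partial (u := fun r t => ∫ s in Ici r, d.fR i s t * d.gR j s t)
      (fun r t => hasDerivAt_integral_Ici (((hs.fR i).contDiff_space t).continuous.mul
        ((hs.gR j).contDiff_space t).continuous) ((hs.fR i).integrableOn_mul (hs.gR j) t) r)
      (fun r t => hasDerivAt_time_integral_Ici (hs.fR i) (hs.gR j) (hs.evR i) (hs.evR' j) r t)
      ((hs.fR i).continuous.mul (hs.gR j).continuous).neg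
      (continuous_flux (hs.fR i) (hs.gR j)).neg
  exact hc.comp (by fun_prop : ContDiff ℝ 1 fun z : ℝ × ℝ × ℝ => (z.2.1 - z.1, z.2.2))

lemma IsScattering.contDiff_space_A (t : ℝ) (k : Fin 2) :
    ContDiff ℝ 2 fun w : ℝ × ℝ => d.A w.1 w.2 t k := by
  have h := ((hs.fL k).contDiff_space t).mul ((hs.gL k).contDiff_space t)
  have hd := hasDerivAt_integral_Iic h.continuous ((hs.fL k).integrableOn_mul (hs.gL k) t)
  have hc : ContDiff ℝ 2 fun r => ∫ s in Iic r, d.fL k s t * d.gL k s t := by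
    refine (contDiff_succ_iff_deriv (n := 1)).2 ⟨fun r => (hd r).differentiableAt, by simp, ?_⟩
    rw [funext fun r => (hd r).deriv]
    exact h.of_le (by norm_num)
  exact hc.comp (by fun_prop : ContDiff ℝ 2 fun w : ℝ × ℝ => w.2 + w.1)

lemma IsScattering.contDiff_space_M (t : ℝ) (i j : Fin 2) :
    ContDiff ℝ 2 fun w : ℝ × ℝ => d.M w.1 w.2 t i j := by
  have h := ((hs.fR i).contDiff_space t).mul ((hs.gR j).contDiff_space t)
  have hd := hasDerivAt_integral_Ici h.continuous ((hs.fR i).integrableOn_mul (hs.gR j) t)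
  have hc : ContDiff ℝ 2 fun r => ∫ s in Ici r, d.fR i s t * d.gR j s t := by
    refine (contDiff_succ_iff_deriv (n := 1)).2 ⟨fun r => (hd r).differentiableAt, by simp, ?_⟩
    rw [funext fun r => (hd r).deriv]
    exact (h.of_le (by norm_num)).neg
  exact hc.comp (by fun_prop : ContDiff ℝ 2 fun w : ℝ × ℝ => w.2 - w.1)

variable {x y t : ℝ} (h : d.Δ x y t ≠ 0)
include h

lemma IsScattering.contDiffAt_q₁₂ (k : Fin 2) :
    ContDiffAt ℝ 1 (fun z : ℝ × ℝ × ℝ => d.q₁₂ k z.1 z.2.1 z.2.2) (x, y, t) ∧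
      ContDiffAt ℝ 2 (fun w : ℝ × ℝ => d.q₁₂ k w.1 w.2 t) (x, y) := by
  simp only [q₁₂_eq]
  rw [Δ_eq] at h
  constructor
  · exact contDiffAt_const.mul ((contDiff_atSum (hs.fL k).contDiff).contDiffAt.mul
      (contDiffAt_resCol (e := (x, y, t)) (fun k => (hs.contDiff_A k).contDiffAt)
        (fun i j => (hs.contDiff_M i j).contDiffAt) h
        (fun k => (contDiff_atDiff (hs.fR k).contDiff).contDiffAt) k))
  · exact contDiffAt_const.mul
      ((contDiff_space_atSum ((hs.fL k).contDiff_space t)).contDiffAt.mul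
      (contDiffAt_resCol (e := (x, y)) (fun k => (hs.contDiff_space_A t k).contDiffAt)
        (fun i j => (hs.contDiff_space_M t i j).contDiffAt) h
        (fun k => (contDiff_space_atDiff ((hs.fR k).contDiff_space t)).contDiffAt) k))

lemma IsScattering.contDiffAt_q₂₁ (k : Fin 2) :
    ContDiffAt ℝ 1 (fun z : ℝ × ℝ × ℝ => d.q₂₁ k z.1 z.2.1 z.2.2) (x, y, t) ∧
      ContDiffAt ℝ 2 (fun w : ℝ × ℝ => d.q₂₁ k w.1 w.2 t) (x, y) := by
  simp only [q₂₁_eq]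
  rw [Δ_eq] at h
  constructor
  · exact contDiffAt_const.mul ((contDiffAt_resRow (e := (x, y, t))
        (fun k => (hs.contDiff_A k).contDiffAt) (fun i j => (hs.contDiff_M i j).contDiffAt) h
        (fun k => (contDiff_atDiff (hs.gR k).contDiff).contDiffAt) k).mul
      (contDiff_atSum (hs.gL k).contDiff).contDiffAt)
  · exact contDiffAt_const.mul ((contDiffAt_resRow (e := (x, y))
        (fun k => (hs.contDiff_space_A t k).contDiffAt)
        (fun i j => (hs.contDiff_space_M t i j).contDiffAt) h
        (fun k => (contDiff_space_atDiff ((hs.gR k).contDiff_space t)).contDiffAt) k).mul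
      (contDiff_space_atSum ((hs.gL k).contDiff_space t)).contDiffAt)

lemma IsScattering.continuousAt_potential :
    ContinuousAt (fun z : ℝ × ℝ × ℝ => d.potential κ z.1 z.2.1 z.2.2) (x, y, t) := by
  rw [Δ_eq] at h
  have hA : ∀ k, Tendsto (fun z : ℝ × ℝ × ℝ => d.A z.1 z.2.1 z.2.2 k) (𝓝 (x, y, t))
    (𝓝 (d.A x y t k)) := fun k => (hs.contDiff_A k).continuous.tendsto (x, y, t)
  have hM : ∀ i j, Tendsto (fun z : ℝ × ℝ × ℝ => d.M z.1 z.2.1 z.2.2 i j) (𝓝 (x, y, t))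
    (𝓝 (d.M x y t i j)) := fun i j => (hs.contDiff_M i j).continuous.tendsto (x, y, t)
  have f₀ := fun k => (continuous_atDiff (hs.fR k).continuous).tendsto (x, y, t)
  have f₁ := fun k => (continuous_atDiff (u := dSpaceVec d.fR)
    (hs.fR k).continuous_dSpace).tendsto (x, y, t)
  have g₀ := fun k => (continuous_atDiff (hs.gR k).continuous).tendsto (x, y, t)
  have g₁ := fun k => (continuous_atDiff (u := dSpaceVec d.gR)
    (hs.gR k).continuous_dSpace).tendsto (x, y, t)
  have hdA := fun k => ((continuous_atSum (hs.fL k).continuous).mul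
    (continuous_atSum (hs.gL k).continuous)).tendsto (x, y, t)
  exact ((((tendsto_finsetSum _ fun l _ => ((tendsto_resRow hA hM h g₀ l).mul (hdA l)).mul
    (tendsto_resCol hA hM h f₀ l)).sub (tendsto_resForm hA hM h g₁ f₀)).sub
    (tendsto_resForm hA hM h g₀ f₁)).add ((tendsto_resForm hA hM h g₀ f₀).pow 2)).const_mul _

lemma IsScattering.contDiffAt_potential :
    ContDiffAt ℝ 1 (fun w : ℝ × ℝ => d.potential κ w.1 w.2 t) (x, y) := by
  rw [Δ_eq] at h
  have hA := fun k => ((hs.contDiff_space_A t k).of_le one_le_two).contDiffAt (x := (x, y))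
  have hM := fun i j => ((hs.contDiff_space_M t i j).of_le one_le_two).contDiffAt (x := (x, y))
  have f₀ := fun k => (contDiff_space_atDiff
    (((hs.fR k).contDiff_space t).of_le one_le_two)).contDiffAt (x := (x, y))
  have f₁ := fun k => (contDiff_space_atDiff (u := dSpaceVec d.fR)
    ((hs.fR k).contDiff_dSpace t)).contDiffAt (x := (x, y))
  have g₀ := fun k => (contDiff_space_atDiff
    (((hs.gR k).contDiff_space t).of_le one_le_two)).contDiffAt (x := (x, y))
  have g₁ := fun k => (contDiff_space_atDiff (u := dSpaceVec d.gR)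
    ((hs.gR k).contDiff_dSpace t)).contDiffAt (x := (x, y))
  have hdA := fun k => ((contDiff_space_atSum (((hs.fL k).contDiff_space t).of_le one_le_two)).mul
    (contDiff_space_atSum
      (((hs.gL k).contDiff_space t).of_le one_le_two))).contDiffAt (x := (x, y))
  exact contDiffAt_const.mul ((((ContDiffAt.sum fun l _ =>
    ((contDiffAt_resRow hA hM h g₀ l).mul (hdA l)).mul (contDiffAt_resCol hA hM h f₀ l)).sub
    (contDiffAt_resForm hA hM h g₁ f₀)).sub (contDiffAt_resForm hA hM h g₀ f₁)).add
    ((contDiffAt_resForm hA hM h g₀ f₀).pow 2))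

lemma IsScattering.continuousAt_matrixPotential (k m : Fin 2) :
    ContinuousAt (fun z : ℝ × ℝ × ℝ => d.matrixPotential B κ k m z.1 z.2.1 z.2.2) (x, y, t) := by
  rw [Δ_eq] at h
  have hA : ∀ k, Tendsto (fun z : ℝ × ℝ × ℝ => d.A z.1 z.2.1 z.2.2 k) (𝓝 (x, y, t))
    (𝓝 (d.A x y t k)) := fun k => (hs.contDiff_A k).continuous.tendsto (x, y, t)
  have hM : ∀ i j, Tendsto (fun z : ℝ × ℝ × ℝ => d.M z.1 z.2.1 z.2.2 i j) (𝓝 (x, y, t))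
    (𝓝 (d.M x y t i j)) := fun i j => (hs.contDiff_M i j).continuous.tendsto (x, y, t)
  have hY := tendsto_resY hA hM h
  have hc := tendsto_resCol hA hM h
    (fun k => (continuous_atDiff (hs.fR k).continuous).tendsto (x, y, t)) k
  have hr := tendsto_resRow hA hM h
    (fun k => (continuous_atDiff (hs.gR k).continuous).tendsto (x, y, t)) m
  have f₀ := (continuous_atSum (hs.fL k).continuous).tendsto (x, y, t)
  have f₁ := (continuous_atSum (u := dSpaceVec d.fL) (hs.fL k).continuous_dSpace).tendsto (x, y, t)
  have g₀ := (continuous_atSum (hs.gL m).continuous).tendsto (x, y, t)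
  have g₁ := (continuous_atSum (u := dSpaceVec d.gL) (hs.gL m).continuous_dSpace).tendsto (x, y, t)
  have hdA := fun k => ((continuous_atSum (hs.fL k).continuous).mul
    (continuous_atSum (hs.gL k).continuous)).tendsto (x, y, t)
  exact (((f₀.mul (hY k m)).mul g₀).const_mul _).sub
    ((((((f₁.mul (hY k m)).mul g₀).add ((f₀.mul (hY k m)).mul g₁)).add
      ((f₀.mul (tendsto_finsetSum _ fun l _ => ((hY k l).mul (hdA l)).mul (hY l m))).mul g₀)).add
      ((f₀.mul (hc.mul hr)).mul g₀)).const_mul _)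

lemma IsScattering.contDiffAt_matrixPotential (k m : Fin 2) :
    ContDiffAt ℝ 1 (fun w : ℝ × ℝ => d.matrixPotential B κ k m w.1 w.2 t) (x, y) := by
  rw [Δ_eq] at h
  have hA := fun k => ((hs.contDiff_space_A t k).of_le one_le_two).contDiffAt (x := (x, y))
  have hM := fun i j => ((hs.contDiff_space_M t i j).of_le one_le_two).contDiffAt (x := (x, y))
  have hY := contDiffAt_resY hA hM h
  have hc := contDiffAt_resCol hA hM h (fun k => (contDiff_space_atDiff
    (((hs.fR k).contDiff_space t).of_le one_le_two)).contDiffAt (x := (x, y))) k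
  have hr := contDiffAt_resRow hA hM h (fun k => (contDiff_space_atDiff
    (((hs.gR k).contDiff_space t).of_le one_le_two)).contDiffAt (x := (x, y))) m
  have f₀ := (contDiff_space_atSum
    (((hs.fL k).contDiff_space t).of_le one_le_two)).contDiffAt (x := (x, y))
  have f₁ := (contDiff_space_atSum (u := dSpaceVec d.fL)
    ((hs.fL k).contDiff_dSpace t)).contDiffAt (x := (x, y))
  have g₀ := (contDiff_space_atSum
    (((hs.gL m).contDiff_space t).of_le one_le_two)).contDiffAt (x := (x, y))
  have g₁ := (contDiff_space_atSum (u := dSpaceVec d.gL)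
    ((hs.gL m).contDiff_dSpace t)).contDiffAt (x := (x, y))
  have hdA := fun k => ((contDiff_space_atSum (((hs.fL k).contDiff_space t).of_le one_le_two)).mul
    (contDiff_space_atSum
      (((hs.gL k).contDiff_space t).of_le one_le_two))).contDiffAt (x := (x, y))
  exact (contDiffAt_const.mul ((f₀.mul (hY k m)).mul g₀)).sub
    (contDiffAt_const.mul (((((f₁.mul (hY k m)).mul g₀).add ((f₀.mul (hY k m)).mul g₁)).add
      ((f₀.mul (ContDiffAt.sum fun l _ => ((hY k l).mul (hdA l)).mul (hY l m))).mul g₀)).add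
      ((f₀.mul (hc.mul hr)).mul g₀)))

end

/-! ### Behaviour at infinity -/

/-- All factors are regular over the whole line. -/
structure IsLineRegular (d : DegenerateData) : Prop where
  fL : ∀ k, IsFactor univ (d.fL k)
  gL : ∀ k, IsFactor univ (d.gL k)
  fR : ∀ k, IsFactor univ (d.fR k)
  gR : ∀ k, IsFactor univ (d.gR k)

lemma LineRegular.isLineRegular (hd : d.LineRegular) : d.IsLineRegular where
  fL k := by fin_cases k; exacts [hd.f₁, hd.f₃]
  gL k := by fin_cases k; exacts [hd.g₂, hd.g₄]
  fR k := by fin_cases k; exacts [hd.f₂, hd.f₄]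
  gR k := by fin_cases k; exacts [hd.g₁, hd.g₃]

lemma tendsto_setIntegral_Iic_atTop {h : ℝ → ℂ} (hi : Integrable h) :
    Tendsto (fun r => ∫ s in Iic r, h s) atTop (𝓝 (∫ s, h s)) :=
  (aecover_Iic tendsto_id).integral_tendsto_of_countably_generated hi

lemma tendsto_setIntegral_Ici_atBot {h : ℝ → ℂ} (hi : Integrable h) :
    Tendsto (fun r => ∫ s in Ici r, h s) atBot (𝓝 (∫ s, h s)) :=
  (aecover_Ici tendsto_id).integral_tendsto_of_countably_generated hi

/-- At `y = +∞` the matrix `M` vanishes, so the resolvents tend to the identity, and the outer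
factors of `p_{km}` tend to zero. -/
lemma IsLineRegular.tendsto_matrixPotential (hd : d.IsLineRegular) (k m : Fin 2) (x t : ℝ) :
    Tendsto (fun y => d.matrixPotential B κ k m x y t) atTop (𝓝 0) := by
  have hp : Tendsto (fun y => y + x) atTop atTop := tendsto_atTop_add_const_right _ _ tendsto_id
  have hq : Tendsto (fun y => y - x) atTop atTop := tendsto_atTop_add_const_right _ _ tendsto_id
  have hA : ∀ k, Tendsto (fun y => d.A x y t k) atTop (𝓝 (∫ s, d.fL k s t * d.gL k s t)) :=
    fun k => (tendsto_setIntegral_Iic_atTop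
      (integrableOn_univ.1 ((hd.fL k).integrableOn_mul (hd.gL k) t))).comp hp
  have hM : ∀ i j, Tendsto (fun y => d.M x y t i j) atTop (𝓝 0) := fun i j =>
    (tendsto_integral_Ici_zero tendsto_id).comp hq
  have lim : ∀ {u : ℝ → ℝ → ℂ}, IsFactor univ u → Tendsto (fun y => u y t) atTop (𝓝 0) ∧
      Tendsto (fun y => dSpace u y t) atTop (𝓝 0) := fun hu =>
    (hu.mono (subset_univ _)).tendsto_atTop t
  have h : resDet (fun k => ∫ s, d.fL k s t * d.gL k s t) (fun _ _ => 0) ≠ 0 := by simp [resDet]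
  have hY := tendsto_resY hA hM h
  have hc := tendsto_resCol (u := fun y => atDiff d.fR x y t) (u₀ := fun _ => 0) hA hM h
    (fun k => (lim (hd.fR k)).1.comp hq) k
  have hr := tendsto_resRow (v := fun y => atDiff d.gR x y t) (v₀ := fun _ => 0) hA hM h
    (fun k => (lim (hd.gR k)).1.comp hq) m
  have f₀ := (lim (hd.fL k)).1.comp hp
  have f₁ := (lim (hd.fL k)).2.comp hp
  have g₀ := (lim (hd.gL m)).1.comp hp
  have g₁ := (lim (hd.gL m)).2.comp hp
  have hdA := fun k => ((lim (hd.fL k)).1.comp hp).mul ((lim (hd.gL k)).1.comp hp)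
  have := (((f₀.mul (hY k m)).mul g₀).const_mul (2 * (B m - B k))).sub
    ((((((f₁.mul (hY k m)).mul g₀).add ((f₀.mul (hY k m)).mul g₁)).add
      ((f₀.mul (tendsto_finsetSum Finset.univ
        fun l _ => ((hY k l).mul (hdA l)).mul (hY l m))).mul g₀)).add
      ((f₀.mul (hc.mul hr)).mul g₀)).const_mul (2 * κ))
  simp only [zero_mul, mul_zero, add_zero, sub_zero] at this
  exact this

/-- At `y = -∞` the matrix `A` vanishes, so the resolvents tend to the identity, and the outer
factors of `p` tend to zero. -/
lemma IsLineRegular.tendsto_potential (hd : d.IsLineRegular) (x t : ℝ) :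
    Tendsto (fun y => d.potential κ x y t) atBot (𝓝 0) := by
  have hp : Tendsto (fun y => y + x) atBot atBot := tendsto_atBot_add_const_right _ _ tendsto_id
  have hq : Tendsto (fun y => y - x) atBot atBot := tendsto_atBot_add_const_right _ _ tendsto_id
  have hA : ∀ k, Tendsto (fun y => d.A x y t k) atBot (𝓝 0) := fun k =>
    (tendsto_integral_Iic_zero tendsto_id).comp hp
  have hM : ∀ i j, Tendsto (fun y => d.M x y t i j) atBot
      (𝓝 (∫ s, d.fR i s t * d.gR j s t)) := fun i j =>
    (tendsto_setIntegral_Ici_atBot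
      (integrableOn_univ.1 ((hd.fR i).integrableOn_mul (hd.gR j) t))).comp hq
  have lim : ∀ {u : ℝ → ℝ → ℂ}, IsFactor univ u → Tendsto (fun y => u y t) atBot (𝓝 0) ∧
      Tendsto (fun y => dSpace u y t) atBot (𝓝 0) := fun hu =>
    (hu.mono (subset_univ _)).tendsto_atBot t
  have h : resDet (fun _ => 0) (fun i j => ∫ s, d.fR i s t * d.gR j s t) ≠ 0 := by simp [resDet]
  have f₀ := fun k => (lim (hd.fR k)).1.comp hq
  have f₁ := fun k => (lim (hd.fR k)).2.comp hq
  have g₀ := fun k => (lim (hd.gR k)).1.comp hq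
  have g₁ := fun k => (lim (hd.gR k)).2.comp hq
  have hdA := fun k => ((lim (hd.fL k)).1.comp hp).mul ((lim (hd.gL k)).1.comp hp)
  have φ : ∀ v u : Fin 2 → ℝ → ℝ → ℂ, (∀ k, Tendsto (fun y => atDiff v x y t k) atBot (𝓝 0)) →
      (∀ k, Tendsto (fun y => atDiff u x y t k) atBot (𝓝 0)) →
      Tendsto (fun y => d.form v u x y t) atBot (𝓝 0) := fun v u hv hu => by
    have := tendsto_resForm (v := fun y => atDiff v x y t) (u := fun y => atDiff u x y t)
      (v₀ := fun _ => 0) (u₀ := fun _ => 0) hA hM h hv hu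
    have e : resForm (fun _ => 0) (fun i j => ∫ s, d.fR i s t * d.gR j s t) (fun _ => 0)
        (fun _ => 0) = 0 := by simp [resForm]
    rw [e] at this
    exact this
  have hc := tendsto_resCol (u := fun y => atDiff d.fR x y t) (u₀ := fun _ => 0) hA hM h f₀
  have hr := tendsto_resRow (v := fun y => atDiff d.gR x y t) (v₀ := fun _ => 0) hA hM h g₀
  have := ((((tendsto_finsetSum Finset.univ fun l _ => ((hr l).mul (hdA l)).mul (hc l)).sub
    (φ (dSpaceVec d.gR) d.fR g₁ f₀)).sub (φ d.gR (dSpaceVec d.fR) g₀ f₁)).add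
    ((φ d.gR d.fR g₀ f₀).pow 2)).const_mul (-2 * κ)
  simp only [zero_mul, mul_zero, Finset.sum_const_zero, sub_zero, add_zero, ne_eq,
    OfNat.ofNat_ne_zero, not_false_eq_true, zero_pow] at this
  exact this

end DegenerateData
end

noncomputable section

/-! ### The Gelfand-Levitan-Marchenko equations -/

lemma integrableOn_Iic_comp_add {E : Type*} [NormedAddCommGroup E] {h : ℝ → E} {x y : ℝ} :
    IntegrableOn (fun s => h (s + x)) (Iic y) ↔ IntegrableOn h (Iic (y + x)) := by
  have e := (measurePreserving_add_right (volume : Measure ℝ) x).integrableOn_comp_preimage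
    (measurableEmbedding_addRight x) (f := h) (s := Iic (y + x))
  have hp : (fun s => s + x) ⁻¹' Iic (y + x) = Iic y := by ext; simp
  rw [hp] at e
  exact e

lemma integrableOn_Ici_comp_sub {E : Type*} [NormedAddCommGroup E] {h : ℝ → E} {x y : ℝ} :
    IntegrableOn (fun s => h (s - x)) (Ici y) ↔ IntegrableOn h (Ici (y - x)) := by
  have e := (measurePreserving_add_right (volume : Measure ℝ) (-x)).integrableOn_comp_preimage
    (measurableEmbedding_addRight (-x)) (f := h) (s := Ici (y - x))
  have hp : (fun s => s + -x) ⁻¹' Ici (y - x) = Ici y := by ext; simp [sub_eq_add_neg]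
  rw [hp] at e
  simpa only [Function.comp_def, ← sub_eq_add_neg] using e

lemma IsFactor.memLp_comp_add {f : ℝ → ℝ → ℂ} (h : IsFactor (Iic 0) f) (x y t : ℝ) :
    MemLp (fun s => f (s + x) t) 2 (volume.restrict (Iic y)) := by
  have hc := (h.contDiff_space t).continuous
  rw [memLp_two_iff_integrable_sq_norm (by fun_prop)]
  exact integrableOn_Iic_comp_add (h := fun s => ‖f s t‖ ^ 2) |>.2
    (integrableOn_Iic_of_continuous (by fun_prop)
      ((memLp_two_iff_integrable_sq_norm (by fun_prop)).1 (h.memLp t)) _)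

lemma IsFactor.memLp_comp_sub {f : ℝ → ℝ → ℂ} (h : IsFactor (Ici 0) f) (x y t : ℝ) :
    MemLp (fun s => f (s - x) t) 2 (volume.restrict (Ici y)) := by
  have hc := (h.contDiff_space t).continuous
  rw [memLp_two_iff_integrable_sq_norm (by fun_prop)]
  exact integrableOn_Ici_comp_sub (h := fun s => ‖f s t‖ ^ 2) |>.2
    (integrableOn_Ici_of_continuous (by fun_prop)
      ((memLp_two_iff_integrable_sq_norm (by fun_prop)).1 (h.memLp t)) _)

section linear

variable {a : Fin 2 → ℂ} {m : Fin 2 → Fin 2 → ℂ} (h : resDet a m ≠ 0)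
include h

/-- The linear system `w = v + w m a` is solved by `v (1 - m a)⁻¹` only. -/
lemma eq_add_iff_resR {w v : Fin 2 → ℂ} :
    (∀ j, w j = v j + (∑ l, w l * m l j) * a j) ↔ ∀ j, w j = ∑ l, v l * resR a m l j := by
  simp only [Fin.forall_fin_two, Fin.sum_univ_two]
  constructor
  · rintro ⟨h₀, h₁⟩
    simp only [resR, Matrix.cons_val_zero, Matrix.cons_val_one]
    constructor <;> field_simp <;> simp only [resDet]
    · linear_combination (1 - a 1 * m 1 1) * h₀ + a 0 * m 1 0 * h₁
    · linear_combination (1 - a 0 * m 0 0) * h₁ + a 1 * m 0 1 * h₀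
  · rintro ⟨h₀, h₁⟩
    simp only [h₀, h₁, resR, Matrix.cons_val_zero, Matrix.cons_val_one]
    constructor <;> field_simp <;> simp only [resDet] <;> ring

/-- The linear system `w = v + w a m` is solved by `v (1 - a m)⁻¹` only. -/
lemma eq_add_iff_resRow {w v : Fin 2 → ℂ} :
    (∀ j, w j = v j + ∑ l, w l * a l * m l j) ↔ ∀ j, w j = resRow a m v j := by
  simp only [resRow, Fin.forall_fin_two, Fin.sum_univ_two]
  constructor
  · rintro ⟨h₀, h₁⟩
    simp only [resN, Matrix.cons_val_zero, Matrix.cons_val_one]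
    constructor <;> field_simp <;> simp only [resDet]
    · linear_combination (1 - a 1 * m 1 1) * h₀ + a 1 * m 1 0 * h₁
    · linear_combination (1 - a 0 * m 0 0) * h₁ + a 0 * m 0 1 * h₀
  · rintro ⟨h₀, h₁⟩
    simp only [h₀, h₁, resN, Matrix.cons_val_zero, Matrix.cons_val_one]
    constructor <;> field_simp <;> simp only [resDet] <;> ring

end linear

namespace DegenerateData

variable {d : DegenerateData} {B : Fin 2 → ℂ} {b κ : ℂ}

lemma F_eq (y τ t : ℝ) (i : Fin 2) : d.F y τ t i = d.fL i y t * d.fR i τ t := by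
  fin_cases i <;> simp [F, fL, fR]

lemma G_eq (y τ t : ℝ) (i : Fin 2) : d.G y τ t i = d.gR i y t * d.gL i τ t := by
  fin_cases i <;> simp [G, gL, gR]

section
variable (hs : d.IsScattering B b κ) {x y t : ℝ}
include hs

lemma IsScattering.integrableOn_left (i : Fin 2) :
    IntegrableOn (fun s => d.fL i (s + x) t * d.gL i (s + x) t) (Iic y) :=
  ((hs.fL i).memLp_comp_add x y t).integrable_mul ((hs.gL i).memLp_comp_add x y t)

lemma IsScattering.integrableOn_right (i j : Fin 2) :
    IntegrableOn (fun s => d.fR i (s - x) t * d.gR j (s - x) t) (Ici y) :=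
  ((hs.fR i).memLp_comp_sub x y t).integrable_mul ((hs.gR j).memLp_comp_sub x y t)

/-- The kernel being degenerate, the equation for `K⁻` says that `K⁻` is a combination of the
factors `f₂`, `f₄` with coefficients determined by finitely many moments of `K⁻`. -/
lemma IsScattering.glmMinus_iff (K : ℝ → Fin 2 → ℂ) (τ : ℝ) :
    d.GLMMinus x y t K τ ↔ ∀ i, K τ i = ∑ j, ((if j = i then atSum d.fL x y t i else 0)
      + (∫ z in Ici y, K z i * d.gR j (z - x) t) * d.A x y t j) * d.fR j (τ - x) t := by
  refine forall_congr' fun i => ?_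
  have e₁ : ∀ s j, (∫ z in Ici y, K z i * d.G (z - x) (s + x) t j) * d.F (s + x) (τ - x) t j
      = (∫ z in Ici y, K z i * d.gR j (z - x) t) * d.fR j (τ - x) t
        * (d.fL j (s + x) t * d.gL j (s + x) t) := by
    intro s j
    simp only [F_eq, G_eq, ← mul_assoc]
    rw [integral_mul_const]
    ring
  have e₂ : ∫ s in Iic y, ∑ j, (∫ z in Ici y, K z i * d.G (z - x) (s + x) t j)
        * d.F (s + x) (τ - x) t j
      = ∑ j, (∫ z in Ici y, K z i * d.gR j (z - x) t) * d.fR j (τ - x) t * d.A x y t j := by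
    simp only [e₁]
    rw [integral_finsetSum _ fun j _ => (hs.integrableOn_left j).const_mul _]
    refine Finset.sum_congr rfl fun j _ => ?_
    rw [integral_const_mul, setIntegral_Iic_comp_add (fun s => d.fL j s t * d.gL j s t)]
    rfl
  rw [e₂, F_eq, sub_eq_iff_eq_add]
  have e₃ : (∑ j, ((if j = i then atSum d.fL x y t i else 0)
      + (∫ z in Ici y, K z i * d.gR j (z - x) t) * d.A x y t j) * d.fR j (τ - x) t)
      = d.fL i (y + x) t * d.fR i (τ - x) t + ∑ j, (∫ z in Ici y, K z i * d.gR j (z - x) t)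
        * d.fR j (τ - x) t * d.A x y t j := by
    simp only [add_mul, Finset.sum_add_distrib, ite_mul, zero_mul, Finset.sum_ite_eq',
      Finset.mem_univ, if_true]
    congr 1
    exact Finset.sum_congr rfl fun j _ => by ring
  rw [e₃]

/-- The moments of a combination of the factors `f₂`, `f₄`. -/
lemma IsScattering.integral_moment_minus (w : Fin 2 → ℂ) (j : Fin 2) :
    ∫ z in Ici y, (∑ l, w l * d.fR l (z - x) t) * d.gR j (z - x) t = ∑ l, w l * d.M x y t l j := by
  simp only [Finset.sum_mul, mul_assoc]
  rw [integral_finsetSum _ fun l _ => (hs.integrableOn_right l j).const_mul _]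
  refine Finset.sum_congr rfl fun l _ => ?_
  rw [integral_const_mul, setIntegral_Ici_comp_sub (fun s => d.fR l s t * d.gR j s t)]
  rfl

/-- The equation for `K⁺` says that `K⁺` is a combination of the factors `g₂`, `g₄` with
coefficients determined by finitely many moments of `K⁺`. -/
lemma IsScattering.glmPlus_iff {K : ℝ → Fin 2 → ℂ}
    (hK : ∀ j, MemLp (fun τ => K τ j) 2 (volume.restrict (Iic y))) (τ : ℝ) :
    d.GLMPlus x y t K τ ↔ ∀ j, K τ j = (atDiff d.gR x y t j
      + ∑ i, (∫ z in Iic y, K z i * d.fL i (z + x) t) * d.M x y t i j) * d.gL j (τ + x) t := by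
  refine forall_congr' fun j => ?_
  have e₁ : ∀ s, (∫ z in Iic y, ∑ i, K z i * d.F (z + x) (s - x) t i) * d.G (s - x) (τ + x) t j
      = ∑ i, (∫ z in Iic y, K z i * d.fL i (z + x) t) * d.gL j (τ + x) t
        * (d.fR i (s - x) t * d.gR j (s - x) t) := by
    intro s
    simp only [F_eq, G_eq, ← mul_assoc]
    rw [integral_finsetSum _ fun i _ => by
      exact ((hK i).integrable_mul ((hs.fL i).memLp_comp_add x y t)).mul_const _]
    simp only [integral_mul_const, Finset.sum_mul]
    exact Finset.sum_congr rfl fun i _ => by ring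
  have e₂ : ∫ s in Ici y, (∫ z in Iic y, ∑ i, K z i * d.F (z + x) (s - x) t i)
        * d.G (s - x) (τ + x) t j
      = ∑ i, (∫ z in Iic y, K z i * d.fL i (z + x) t) * d.gL j (τ + x) t * d.M x y t i j := by
    simp only [e₁]
    rw [integral_finsetSum _ fun i _ => (hs.integrableOn_right i j).const_mul _]
    refine Finset.sum_congr rfl fun i _ => ?_
    rw [integral_const_mul, setIntegral_Ici_comp_sub (fun s => d.fR i s t * d.gR j s t)]
    rfl
  rw [e₂, G_eq, sub_eq_iff_eq_add, add_mul, Finset.sum_mul]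
  have e₃ : ∀ i, (∫ z in Iic y, K z i * d.fL i (z + x) t) * d.M x y t i j * d.gL j (τ + x) t
      = (∫ z in Iic y, K z i * d.fL i (z + x) t) * d.gL j (τ + x) t * d.M x y t i j :=
    fun i => by ring
  simp only [e₃]
  rfl

omit hs in
/-- The moments of a multiple of a factor `g₂`, `g₄`. -/
lemma integral_moment_plus (w : ℂ) (j : Fin 2) :
    ∫ z in Iic y, w * d.gL j (z + x) t * d.fL j (z + x) t = w * d.A x y t j := by
  simp only [mul_assoc]
  rw [integral_const_mul, setIntegral_Iic_comp_add (fun s => d.gL j s t * d.fL j s t)]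
  simp only [A, mul_comm]

variable (h : d.Δ x y t ≠ 0)

lemma IsScattering.memLp_Kminus (i : Fin 2) :
    MemLp (fun τ => d.Kminus x y τ t i) 2 (volume.restrict (Ici y)) := by
  simp only [Kminus_eq]
  exact (memLp_finsetSum _ fun j _ => ((hs.fR j).memLp_comp_sub x y t).const_mul _).const_mul _

lemma IsScattering.memLp_Kplus (j : Fin 2) :
    MemLp (fun τ => d.Kplus x y τ t j) 2 (volume.restrict (Iic y)) := by
  simp only [Kplus_eq]
  exact ((hs.gL j).memLp_comp_add x y t).const_mul _

include h

lemma IsScattering.glmMinus_Kminus (τ : ℝ) :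
    d.GLMMinus x y t (fun τ => d.Kminus x y τ t) τ := by
  rw [hs.glmMinus_iff]
  intro i
  rw [Δ_eq] at h
  have hK : ∀ z, d.Kminus x y z t i = ∑ j,
      (∑ l, (if l = i then atSum d.fL x y t i else 0) * resR (d.A x y t) (d.M x y t) l j)
        * d.fR j (z - x) t := fun z => by
    simp only [Kminus_eq, ite_mul, zero_mul, Finset.sum_ite_eq', Finset.mem_univ, if_true,
      Finset.mul_sum, mul_assoc]
  have := (eq_add_iff_resR h (v := fun l => if l = i then atSum d.fL x y t i else 0)).2
    fun j => rfl
  simp only [hK, hs.integral_moment_minus]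
  exact Finset.sum_congr rfl fun j _ => by rw [← this j]

lemma IsScattering.glmPlus_Kplus (τ : ℝ) :
    d.GLMPlus x y t (fun τ => d.Kplus x y τ t) τ := by
  rw [hs.glmPlus_iff hs.memLp_Kplus]
  intro j
  rw [Δ_eq] at h
  have := (eq_add_iff_resRow h (v := atDiff d.gR x y t)).2 fun j => rfl
  simp only [Kplus_eq, integral_moment_plus]
  congr 1
  exact this j

lemma IsScattering.eq_Kminus {K : ℝ → Fin 2 → ℂ}
    (hK : ∀ᵐ τ ∂(volume.restrict (Ici y)), d.GLMMinus x y t K τ) :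
    ∀ᵐ τ ∂(volume.restrict (Ici y)), K τ = d.Kminus x y τ t := by
  rw [Δ_eq] at h
  have hK' : ∀ᵐ τ ∂(volume.restrict (Ici y)), _ := hK.mono fun τ => (hs.glmMinus_iff K τ).1
  -- the moments of `K` solve a linear system with matrix `1 - M A`
  have key : ∀ i j, (if j = i then atSum d.fL x y t i else 0)
      + (∫ z in Ici y, K z i * d.gR j (z - x) t) * d.A x y t j
      = ∑ l, (if l = i then atSum d.fL x y t i else 0) * resR (d.A x y t) (d.M x y t) l j := by
    intro i
    refine (eq_add_iff_resR h).1 fun j => ?_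
    rw [← hs.integral_moment_minus, integral_congr_ae (hK'.mono fun z hz => by
      simp only [hz i]; rfl)]
  filter_upwards [hK'] with τ hτ
  funext i
  rw [hτ i, Kminus_eq]
  simp only [key, ite_mul, zero_mul, Finset.sum_ite_eq', Finset.mem_univ, if_true, Finset.mul_sum,
    mul_assoc]

lemma IsScattering.eq_Kplus {K : ℝ → Fin 2 → ℂ}
    (hL : ∀ j, MemLp (fun τ => K τ j) 2 (volume.restrict (Iic y)))
    (hK : ∀ᵐ τ ∂(volume.restrict (Iic y)), d.GLMPlus x y t K τ) :
    ∀ᵐ τ ∂(volume.restrict (Iic y)), K τ = d.Kplus x y τ t := by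
  rw [Δ_eq] at h
  have hK' : ∀ᵐ τ ∂(volume.restrict (Iic y)), _ := hK.mono fun τ => (hs.glmPlus_iff hL τ).1
  -- the moments of `K` solve a linear system with matrix `1 - A M`
  have mom : ∀ i, ∫ z in Iic y, K z i * d.fL i (z + x) t = (atDiff d.gR x y t i
      + ∑ l, (∫ z in Iic y, K z l * d.fL l (z + x) t) * d.M x y t l i) * d.A x y t i := by
    intro i
    rw [← integral_moment_plus, integral_congr_ae (hK'.mono fun z hz => by
      simp only [hz i]; rfl)]
  have key : ∀ j, atDiff d.gR x y t j
      + ∑ i, (∫ z in Iic y, K z i * d.fL i (z + x) t) * d.M x y t i j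
      = resRow (d.A x y t) (d.M x y t) (atDiff d.gR x y t) j := by
    refine (eq_add_iff_resRow h).1 fun j => ?_
    simp only [← mom]
  filter_upwards [hK'] with τ hτ
  funext j
  rw [hτ j, Kplus_eq, key]
  rfl

end

end DegenerateData

end

end FourWave

theorem mainTheorem4 (α β : Fin 2 → ℝ) (γ b₁ b₂ b : ℝ)
    (hb₁ : b₁ = (β 0 - α 0) / 2) (hb₂ : b₂ = (β 1 - α 1) / 2)
    (hb : b = -(β 0 + α 0) / 2) (hb' : b = -(β 1 + α 1) / 2)
    (d : FourWave.DegenerateData) (hd : d.HalfLineRegular) (hev : d.Evolves b₁ b₂ b γ) :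
    -- the Gelfand-Levitan-Marchenko equations are uniquely solved by the explicit kernels
    (∀ x y t : ℝ, d.Δ x y t ≠ 0 →
      ((∀ i, MemLp (fun τ => d.Kminus x y τ t i) 2 (volume.restrict (Ici y))) ∧
        (∀ τ, y ≤ τ → d.GLMMinus x y t (fun τ' => d.Kminus x y τ' t) τ) ∧
        (∀ K : ℝ → Fin 2 → ℂ,
          (∀ i, MemLp (fun τ => K τ i) 2 (volume.restrict (Ici y))) →
          (∀ᵐ τ ∂(volume.restrict (Ici y)), d.GLMMinus x y t K τ) →
          ∀ᵐ τ ∂(volume.restrict (Ici y)), K τ = d.Kminus x y τ t)) ∧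
      ((∀ j, MemLp (fun τ => d.Kplus x y τ t j) 2 (volume.restrict (Iic y))) ∧
        (∀ τ, τ ≤ y → d.GLMPlus x y t (fun τ' => d.Kplus x y τ' t) τ) ∧
        (∀ K : ℝ → Fin 2 → ℂ,
          (∀ j, MemLp (fun τ => K τ j) 2 (volume.restrict (Iic y))) →
          (∀ᵐ τ ∂(volume.restrict (Iic y)), d.GLMPlus x y t K τ) →
          ∀ᵐ τ ∂(volume.restrict (Iic y)), K τ = d.Kplus x y τ t))) ∧
    -- the potential built from them solves the dispersive 4-wave system
    (∃ (p : ℝ → ℝ → ℝ → ℂ) (P : Fin 2 → Fin 2 → ℝ → ℝ → ℝ → ℂ),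
      FourWave.IsSolutionOn {z | d.Δ z.1 z.2.1 z.2.2 ≠ 0} α β γ d.q₁₂ d.q₂₁ p P ∧
      (d.LineRegular → ∀ x t : ℝ,
        (∀ k m, Tendsto (fun y => P k m x y t) atTop (𝓝 0)) ∧
        Tendsto (fun y => p x y t) atBot (𝓝 0))) := by
  have hs := hd.isScattering hev
  have hα : ∀ k, (α k : ℂ) = -((![(b₁ : ℂ), (b₂ : ℂ)] : Fin 2 → ℂ) k + b) := by
    intro k
    fin_cases k
    · simp only [hb₁, hb]; push_cast; simp; ring
    · simp only [hb₂, hb']; push_cast; simp; ring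
  have hβ : ∀ k, (β k : ℂ) = (![(b₁ : ℂ), (b₂ : ℂ)] : Fin 2 → ℂ) k - b := by
    intro k
    fin_cases k
    · simp only [hb₁, hb]; push_cast; simp; ring
    · simp only [hb₂, hb']; push_cast; simp; ring
  refine ⟨fun x y t h => ⟨⟨hs.memLp_Kminus, fun τ _ => hs.glmMinus_Kminus h τ,
      fun K _ hK => hs.eq_Kminus h hK⟩,
    hs.memLp_Kplus, fun τ _ => hs.glmPlus_Kplus h τ, fun K hL hK => hs.eq_Kplus h hL hK⟩,
    d.potential (Complex.I * γ), d.matrixPotential ![(b₁ : ℂ), (b₂ : ℂ)] (Complex.I * γ), ?_, ?_⟩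
  · exact {
      regU := fun k x y t h => hs.contDiffAt_q₁₂ h k
      regV := fun k x y t h => hs.contDiffAt_q₂₁ h k
      regp := fun x y t h => ⟨hs.continuousAt_potential h, hs.contDiffAt_potential h⟩
      regP := fun k m x y t h =>
        ⟨hs.continuousAt_matrixPotential h k m, hs.contDiffAt_matrixPotential h k m⟩
      eqU := fun k x y t h => by
        rw [← hs.eq_q₁₂ h k, hα, hβ]; ring
      eqV := fun k x y t h => by
        rw [← hs.eq_q₂₁ h k, hα, hβ]; ring
      eqp := fun x y t h => hs.eq_potential h
      eqP := fun k m x y t h => by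
        rw [hs.eq_matrixPotential h k m, hβ, hβ]; ring }
  · intro hL x t
    exact ⟨fun k m => hL.isLineRegular.tendsto_matrixPotential k m x t,
      hL.isLineRegular.tendsto_potential x t⟩
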